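/- **Setting.** Let $n\ge 2$ and let $A\in\mathbb R^{n\times n}$ be Hurwitz. Fix a set $\mathcal E_p$ of index pairs and bounds $\underline\Delta_{ij}\in[-\infty,0]$, $\bar\Delta_{ij}\in[0,+\infty]$, and let $\mathcal H$ be the set of real matrices $\Delta$ with $\Delta_{ij}=0$ for $(i,j)\notin\mathcal E_p$ and $\underline\Delta_{ij}\le\Delta_{ij}\le\bar\Delta_{ij}$ for $(i,j)\in\mathcal E_p$. Let $\|\cdot\|_F$ be the Frobenius norm, $\mathbb B_\epsilon$ its closed ball of radius $\epsilon$, $\alpha(\cdot)$ the spectral abscissa, $\alpha_{\epsilon,\mathcal H}(A)=\max\{\alpha(A+\Delta):\Delta\in\mathcal H\cap\mathbb B_\epsilon\}$ (a maximizer is called a worst-case perturbation of energy $\epsilon$), and $r_{\mathcal H}(A)=\min\{\epsilon\ge0:\alpha_{\epsilon,\mathcal H}(A)\ge0\}$, which is assumed to exist. Vectors $x,y\in\mathbb C^n$ are RP-compatible if $|x|=|y|=1$ and $y^*x$ is real and positive. Put $\langle\Delta,M\rangle=\sum_{i,j}\Delta_{ij}M_{ij}$. **Algorithm 1** (input $\epsilon>0$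 and $M\in\mathbb R^{n\times n}$). Start with $\bar S=\underline S=\emptyset$. Compute $\theta=\Big(\big(\epsilon^2-\sum_{\bar S}\bar\Delta_{ij}^2-\sum_{\underline S}\underline\Delta_{ij}^2\big)\big/\sum_{\mathcal E_p\setminus(\bar S\cup\underline S)}m_{ij}^2\Big)^{1/2}$; move every $(i,j)\in\mathcal E_p\setminus(\bar S\cup\underline S)$ with $m_{ij}\theta\ge\bar\Delta_{ij}$ into $\bar S$, and every other one with $m_{ij}\theta\le\underline\Delta_{ij}$ into $\underline S$; repeat until nothing is moved. Return $\theta$ and the matrix $\Delta$ equal to $\bar\Delta_{ij}$ on $\bar S$, $\underline\Delta_{ij}$ on $\underline S$, $m_{ij}\theta$ on the rest of $\mathcal E_p$, and $0$ elsewhere. (There is no output if $\bar S\cup\underline S=\mathcal E_p$ or if the denominator vanishes.) **Algorithm 2** (input $\epsilon$, $\Delta_0$, $\epsilon_{\rm tol}$, $k_{\max}$). For $j=0,1,\dots,k_{\max}$: take a rightmost eigenvalue $\lambda_j$ of $A+\Delta_j$ with RP-compatible right and left eigenvectors $x_j,y_j$, and let Algorithm 1 with input $\epsilon$, $M=\operatorname{Re}(y_jx_j^*)$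 return $\theta_j,\Delta_{j+1}$; stop as soon as $\|\Delta_{j+1}-\Delta_j\|_F\le\epsilon_{\rm tol}$. Return $\Delta_{j+1}$, $\operatorname{Re}\lambda_{j+1}$, $x_{j+1}$, $y_{j+1}$, $\theta_j$. **Algorithm 3** (input $\epsilon_0>0$, $\epsilon_{\rm tol},\alpha_{\rm tol}>0$, $k_{\max}$, $l_{\max}$, $\zeta\in(0,1)$). For $l=0,1,\dots,l_{\max}$: choose $\Delta_{\rm init}\in\mathcal H\cap\mathbb B_{\epsilon_l}$; let Algorithm 2 with input $\epsilon_l,\Delta_{\rm init},\epsilon_{\rm tol},k_{\max}$, ended by its stopping criterion, return $\Delta_l,\alpha_l,x_l,y_l,\theta_l$; put $\alpha_l'=\epsilon_l/((y_l^*x_l)\theta_l)$ and $\epsilon_{l+1}=\max\{\epsilon_l-\alpha_l/\alpha_l',\ \zeta\epsilon_l\}$; terminate at the first $l$ with $|\alpha_l|\le\alpha_{\rm tol}$. **Regularity at $\epsilon=r_{\mathcal H}(A)$.** For every worst-case perturbation $\Delta$ of energy $\epsilon$, the rightmost eigenvalue $\lambda$ of $A+\Delta$ is simple and unique up to complex conjugation;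 and if $x,y$ are its RP-compatible right and left eigenvectors and $M=\operatorname{Re}(yx^*)$, then every maximizer $\hat\Delta$ of $\langle\cdot,M\rangle$ over $\mathcal H\cap\mathbb B_\epsilon$ has an entry $(i,j)\in\mathcal E_p$ with $\underline\Delta_{ij}<\hat\Delta_{ij}<\bar\Delta_{ij}$ and $m_{ij}\ne0$. **Theorem (Error bound for Algorithm 3).** Under these assumptions let $c,\delta>0$. There is a constant $C>0$ with the following property. Consider any family of runs of Algorithm 3 (the inputs $\epsilon_0,\zeta,k_{\max},l_{\max}$ and all choices made in the run may vary), along which $\epsilon_{\rm tol}\to0^+$ and $\alpha_{\rm tol}\to0^+$, each terminating at an iteration $k<l_{\max}$ (with $k$ depending on the run). Suppose that along the family the inner algorithm converges to the structured pseudospectral abscissa in all outer iterations, i.e. $\max_{0\le l\le k}|\alpha_l-\alpha_{\epsilon_l,\mathcal H}(A)|\to0$, and that the perturbation $\Delta_k$ returned in the terminal iteration satisfies $\|\Delta_k-\Delta_{\rm opt}\|_F\to0$ for worst-case perturbations $\Delta_{\rm opt}$ of energy $\epsilon_k$. Let $\lambda$ be a rightmost eigenvalue of $A+\Delta_{\rm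 opt}$ with RP-compatible right and left eigenvectors $x,y$, let $M=\operatorname{Re}(yx^*)$, and suppose that $c$ is a sensitivity constant, i.e. $\|\tilde D-D\|_F\le c\,\epsilon_k\|\tilde M-M\|_F$ for all real $\tilde M$ with $\|\tilde M\|_F\le1$, $\|\tilde M-M\|_F\le\delta$ and all maximizers $D$, $\tilde D$ of $\langle\cdot,M\rangle$, $\langle\cdot,\tilde M\rangle$ over $\mathcal H\cap\mathbb B_{\epsilon_k}$. Suppose finally that $$ r:=\frac{4\sqrt n\,c\,\epsilon_k}{\sigma_{n-1}(A+\Delta_{\rm opt}-\lambda I)\,(y^*x)^2}<1, $$ where $\sigma_{n-1}$ is the second smallest singular value. Then eventually along the family $$ |\epsilon_k-r_{\mathcal H}(A)|\le C\Big(\frac{r}{1-r}\,\epsilon_{\rm tol}+\alpha_{\rm tol}\Big), $$ that is, $|\epsilon_k-r_{\mathcal H}(A)|=O\big(\frac r{1-r}\epsilon_{\rm tol}+\alpha_{\rm tol}\big)$ as the tolerances tend to $0$. -/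

import Mathlib

open Filter Topology
open scoped Matrix Matrix.Norms.Frobenius

noncomputable section

/-- The complex matrix with the entries of the real matrix `B`. -/
def toComplex {n : ℕ} (B : Matrix (Fin n) (Fin n) ℝ) : Matrix (Fin n) (Fin n) ℂ :=
  B.map Complex.ofReal

/-- A real square matrix is Hurwitz if all its eigenvalues have negative real part. -/
def IsHurwitz {n : ℕ} (B : Matrix (Fin n) (Fin n) ℝ) : Prop :=
  ∀ z ∈ spectrum ℂ (toComplex B), z.re < 0

/-- The spectral abscissa: the largest real part of an eigenvalue. -/
def spectralAbscissa {n : ℕ} (B : Matrix (Fin n) (Fin n) ℝ) : ℝ :=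
  sSup (Complex.re '' spectrum ℂ (toComplex B))

/-- `z` is a rightmost eigenvalue of `B`. -/
def IsRightmost {n : ℕ} (B : Matrix (Fin n) (Fin n) ℝ) (z : ℂ) : Prop :=
  z ∈ spectrum ℂ (toComplex B) ∧ ∀ w ∈ spectrum ℂ (toComplex B), w.re ≤ z.re

/-- "The rightmost eigenvalue of `B` is simple": every rightmost eigenvalue is an algebraically
simple eigenvalue, and, `B` being real, the rightmost eigenvalue is unique up to complex
conjugation. -/
def HasSimpleRightmost {n : ℕ} (B : Matrix (Fin n) (Fin n) ℝ) : Prop :=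
  ∀ z, IsRightmost B z →
    (toComplex B).charpoly.rootMultiplicity z = 1 ∧
      ∀ w, IsRightmost B w → w = z ∨ w = star z

/-- `x`, `y` are RP-compatible right and left eigenvectors of `B` for the eigenvalue `z`:
`B x = z x`, `y* B = z y*`, `|x| = |y| = 1`, and `y* x` is real and positive. -/
structure IsRPPair {n : ℕ} (B : Matrix (Fin n) (Fin n) ℝ) (z : ℂ) (x y : Fin n → ℂ) : Prop where
  right : toComplex B *ᵥ x = z • x
  left : star y ᵥ* toComplex B = z • star y
  unit_right : star x ⬝ᵥ x = 1
  unit_left : star y ⬝ᵥ y = 1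
  real : (star y ⬝ᵥ x).im = 0
  pos : 0 < (star y ⬝ᵥ x).re

/-- The real matrix `Re (y x*)`. -/
def gradMatrix {n : ℕ} (x y : Fin n → ℂ) : Matrix (Fin n) (Fin n) ℝ :=
  Matrix.of fun i j => (y i * star (x j)).re

/-- The data of a structured perturbation set: the edges that may be perturbed and the saturation
bounds `lo i j ∈ [-∞, 0]`, `hi i j ∈ [0, +∞]` on the perturbation of the edge `(i, j)`. -/
structure PerturbationSet (n : ℕ) where
  edges : Finset (Fin n × Fin n)
  lo : Fin n → Fin n → EReal
  hi : Fin n → Fin n → EReal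
  lo_nonpos : ∀ i j, lo i j ≤ 0
  hi_nonneg : ∀ i j, 0 ≤ hi i j

namespace PerturbationSet

variable {n : ℕ} (P : PerturbationSet n)

/-- The set `𝓗` of allowed perturbations. -/
def carrier : Set (Matrix (Fin n) (Fin n) ℝ) :=
  {D | (∀ i j, (i, j) ∉ P.edges → D i j = 0) ∧
    ∀ i j, (i, j) ∈ P.edges → P.lo i j ≤ (D i j : EReal) ∧ (D i j : EReal) ≤ P.hi i j}

/-- `𝓗 ∩ 𝔹_ε`, where `𝔹_ε` is the closed ball of radius `ε` for the Frobenius norm. -/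
def feasible (ε : ℝ) : Set (Matrix (Fin n) (Fin n) ℝ) :=
  {D | D ∈ P.carrier ∧ ‖D‖ ≤ ε}

/-- The structured `ε`-pseudospectrum of `A`. -/
def pseudospectrum (A : Matrix (Fin n) (Fin n) ℝ) (ε : ℝ) : Set ℂ :=
  {z | ∃ D ∈ P.feasible ε, z ∈ spectrum ℂ (toComplex (A + D))}

/-- The structured `ε`-pseudospectral abscissa of `A`. -/
def pseudoAbscissa (A : Matrix (Fin n) (Fin n) ℝ) (ε : ℝ) : ℝ :=
  sSup (Complex.re '' P.pseudospectrum A ε)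

/-- The radii `ε ≥ 0` for which the structured `ε`-pseudospectral abscissa is nonnegative. -/
def destabilizing (A : Matrix (Fin n) (Fin n) ℝ) : Set ℝ :=
  {ε | 0 ≤ ε ∧ 0 ≤ P.pseudoAbscissa A ε}

/-- The structured stability radius of `A`. -/
def stabilityRadius (A : Matrix (Fin n) (Fin n) ℝ) : ℝ :=
  sInf (P.destabilizing A)

/-- `D` is a worst-case structured perturbation of energy `ε`. -/
def IsWorstCase (A : Matrix (Fin n) (Fin n) ℝ) (ε : ℝ) (D : Matrix (Fin n) (Fin n) ℝ) : Prop :=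
  D ∈ P.feasible ε ∧ ∀ D' ∈ P.feasible ε, spectralAbscissa (A + D') ≤ spectralAbscissa (A + D)

/-- `D` maximizes `⟨D, M⟩` over `𝓗 ∩ 𝔹_ε`. -/
def IsLinearOptimizer (ε : ℝ) (M D : Matrix (Fin n) (Fin n) ℝ) : Prop :=
  D ∈ P.feasible ε ∧
    ∀ D' ∈ P.feasible ε, ∑ i, ∑ j, D' i j * M i j ≤ ∑ i, ∑ j, D i j * M i j

/-- Non-saturation: every maximizer of `⟨D, M⟩` over `𝓗 ∩ 𝔹_ε` has an unsaturated edge `(i, j)`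
with `M i j ≠ 0`. -/
def NonSaturated (ε : ℝ) (M : Matrix (Fin n) (Fin n) ℝ) : Prop :=
  ∀ D, P.IsLinearOptimizer ε M D →
    ∃ i j, (i, j) ∈ P.edges ∧ P.lo i j < (D i j : EReal) ∧ (D i j : EReal) < P.hi i j ∧ M i j ≠ 0

/-- `c` (with radius `δ`) is a sensitivity constant at `(ε, M)`: a maximizer for `M' ∈ 𝔹_1` with
`‖M' - M‖ ≤ δ` is within `c ε ‖M' - M‖` of a maximizer for `M`. -/
def IsSensitivityConst (ε : ℝ) (M : Matrix (Fin n) (Fin n) ℝ) (c δ : ℝ) : Prop :=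
  ∀ M' : Matrix (Fin n) (Fin n) ℝ, ‖M'‖ ≤ 1 → ‖M' - M‖ ≤ δ →
    ∀ D D', P.IsLinearOptimizer ε M D → P.IsLinearOptimizer ε M' D' →
      ‖D' - D‖ ≤ c * ε * ‖M' - M‖

/-- Every worst-case perturbation of energy `ε` yields a simple rightmost eigenvalue, and
non-saturation holds for `M = Re (y x*)`, where `x`, `y` are the RP-compatible eigenvectors. -/
def IsRegularAt (A : Matrix (Fin n) (Fin n) ℝ) (ε : ℝ) : Prop :=
  ∀ D, P.IsWorstCase A ε D →
    HasSimpleRightmost (A + D) ∧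
      ∀ z x y, IsRightmost (A + D) z → IsRPPair (A + D) z x y →
        P.NonSaturated ε (gradMatrix x y)

/-! ### Incremental construction of the index sets of saturation -/

/-- The ratio `θ(ε, M, S̄, S̲)`; here `S.1 = S̄` (upper) and `S.2 = S̲` (lower). -/
def theta (ε : ℝ) (M : Matrix (Fin n) (Fin n) ℝ)
    (S : Finset (Fin n × Fin n) × Finset (Fin n × Fin n)) : ℝ :=
  √((ε ^ 2 - ∑ e ∈ S.1, (P.hi e.1 e.2).toReal ^ 2 - ∑ e ∈ S.2, (P.lo e.1 e.2).toReal ^ 2) /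
    ∑ e ∈ P.edges \ (S.1 ∪ S.2), M e.1 e.2 ^ 2)

open Classical in
/-- One pass of the algorithm: with `θ` computed from the current index sets, every edge not yet
saturated with `m θ ≥ hi` joins the upper set, and otherwise every one with `m θ ≤ lo` joins the
lower set. -/
def growSets (ε : ℝ) (M : Matrix (Fin n) (Fin n) ℝ)
    (S : Finset (Fin n × Fin n) × Finset (Fin n × Fin n)) :
    Finset (Fin n × Fin n) × Finset (Fin n × Fin n) :=
  (S.1 ∪ (P.edges \ (S.1 ∪ S.2)).filter
      (fun e => P.hi e.1 e.2 ≤ ((M e.1 e.2 * P.theta ε M S : ℝ) : EReal)),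
   S.2 ∪ (P.edges \ (S.1 ∪ S.2)).filter
      (fun e => ¬ P.hi e.1 e.2 ≤ ((M e.1 e.2 * P.theta ε M S : ℝ) : EReal) ∧
        ((M e.1 e.2 * P.theta ε M S : ℝ) : EReal) ≤ P.lo e.1 e.2))

open Classical in
/-- The perturbation determined by index sets of saturation and a ratio `θ`. -/
def assemble (M : Matrix (Fin n) (Fin n) ℝ)
    (S : Finset (Fin n × Fin n) × Finset (Fin n × Fin n)) (θ : ℝ) :
    Matrix (Fin n) (Fin n) ℝ :=
  Matrix.of fun i j =>
    if (i, j) ∉ P.edges then 0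
    else if (i, j) ∈ S.1 then (P.hi i j).toReal
    else if (i, j) ∈ S.2 then (P.lo i j).toReal
    else M i j * θ

/-- The algorithm, started with empty index sets on the input `(ε, M)`, stops after finitely many
passes without error and returns `(θ, D)`. It stops as soon as a pass adds no edge. It returns
nothing if all edges get saturated, or if the denominator in the formula for `θ` vanishes; the index
sets only grow, so that it suffices to rule this out at the end. -/
def LinearAlgReturns (ε : ℝ) (M : Matrix (Fin n) (Fin n) ℝ) (θ : ℝ)
    (D : Matrix (Fin n) (Fin n) ℝ) : Prop :=
  ∃ (N : ℕ) (S : Finset (Fin n × Fin n) × Finset (Fin n × Fin n)),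
    S = (P.growSets ε M)^[N] (∅, ∅) ∧ P.growSets ε M S = S ∧
      S.1 ∪ S.2 ≠ P.edges ∧ ∑ e ∈ P.edges \ (S.1 ∪ S.2), M e.1 e.2 ^ 2 ≠ 0 ∧
      θ = P.theta ε M S ∧ D = P.assemble M S θ

end PerturbationSet

/-! ### The fixed-point iteration for the structured pseudospectral abscissa -/

/-- The quantities computed in a run of the fixed-point iteration; `last` is the index of the pass
after which it stops. -/
structure InnerTrace (n : ℕ) where
  pert : ℕ → Matrix (Fin n) (Fin n) ℝ
  eig : ℕ → ℂ
  x : ℕ → Fin n → ℂ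
  y : ℕ → Fin n → ℂ
  ratio : ℕ → ℝ
  last : ℕ

namespace InnerTrace

variable {n : ℕ} (T : InnerTrace n)

/-- `T` is a run of the fixed-point iteration with inputs `A`, `ε`, `𝓗`, the initial guess
`T.pert 0`, the tolerance `εtol` and `kmax`, ended by its stopping criterion. Which rightmost
eigenvalue and which RP-compatible eigenvectors are computed is left open. -/
structure IsRun (P : PerturbationSet n) (A : Matrix (Fin n) (Fin n) ℝ) (ε εtol : ℝ) (kmax : ℕ) :
    Prop where
  eig_spec : ∀ j ≤ T.last + 1, IsRightmost (A + T.pert j) (T.eig j)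
  vec_spec : ∀ j ≤ T.last + 1, IsRPPair (A + T.pert j) (T.eig j) (T.x j) (T.y j)
  step : ∀ j ≤ T.last,
    P.LinearAlgReturns ε (gradMatrix (T.x j) (T.y j)) (T.ratio j) (T.pert (j + 1))
  last_le : T.last ≤ kmax
  continued : ∀ j < T.last, εtol < ‖T.pert (j + 1) - T.pert j‖
  stopped : ‖T.pert (T.last + 1) - T.pert T.last‖ ≤ εtol

/-- The returned perturbation. -/
def outPert : Matrix (Fin n) (Fin n) ℝ := T.pert (T.last + 1)

/-- The returned approximation of the structured pseudospectral abscissa. -/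
def outAbscissa : ℝ := (T.eig (T.last + 1)).re

/-- The returned right eigenvector. -/
def outX : Fin n → ℂ := T.x (T.last + 1)

/-- The returned left eigenvector. -/
def outY : Fin n → ℂ := T.y (T.last + 1)

/-- The returned ratio `θ`. -/
def outRatio : ℝ := T.ratio T.last

end InnerTrace

/-! ### The Newton-type iteration for the structured stability radius -/

/-- The quantities computed in a run of the Newton-type iteration: the energies `ε_l`, the inner
runs, and the index `last` of the iteration at which it terminates. -/
structure NewtonTrace (n : ℕ) where
  energy : ℕ → ℝ
  inner : ℕ → InnerTrace n
  last : ℕ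

namespace NewtonTrace

variable {n : ℕ} (R : NewtonTrace n)

/-- The computed derivative `ε_l / ((y_l* x_l) θ_l)` of the structured pseudospectral abscissa. -/
def slope (l : ℕ) : ℝ :=
  R.energy l /
    ((star (R.inner l).outY ⬝ᵥ (R.inner l).outX).re * (R.inner l).outRatio)

/-- `R` is a run of the Newton-type iteration with the given inputs that terminates, by its stopping
criterion, at the iteration `R.last < lmax`. The choice of the initial guesses of the inner runs in
`𝓗 ∩ 𝔹_{ε_l}` is left open. -/
structure IsRun (P : PerturbationSet n) (A : Matrix (Fin n) (Fin n) ℝ) (ε₀ εtol αtol ζ : ℝ)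
    (kmax lmax : ℕ) : Prop where
  energy_zero : R.energy 0 = ε₀
  init_mem : ∀ l ≤ R.last, (R.inner l).pert 0 ∈ P.feasible (R.energy l)
  inner_run : ∀ l ≤ R.last, (R.inner l).IsRun P A (R.energy l) εtol kmax
  newton : ∀ l < R.last, R.energy (l + 1) =
    max (R.energy l - (R.inner l).outAbscissa / R.slope l) (ζ * R.energy l)
  last_lt : R.last < lmax
  continued : ∀ l < R.last, αtol < |(R.inner l).outAbscissa|
  stopped : |(R.inner R.last).outAbscissa| ≤ αtol

/-- The energy `ε_k` at termination. -/
def finalEnergy : ℝ := R.energy R.last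

end NewtonTrace

/-- The second smallest singular value `σ_{n-1}` of an `n × n` matrix. (Mathlib lists the singular
values in decreasing order, starting from index `0`.) -/
def secondSmallestSingularValue {n : ℕ} (B : Matrix (Fin n) (Fin n) ℂ) : ℝ :=
  (Matrix.toEuclideanLin B).singularValues (n - 2)

/-- The rate `r = 4 √n c ε / (σ_{n-1}(B - z I) (y* x)²)`. -/
def convergenceRate {n : ℕ} (c ε : ℝ) (B : Matrix (Fin n) (Fin n) ℝ) (z : ℂ) (x y : Fin n → ℂ) :
    ℝ :=
  4 * √(n : ℝ) * c * ε /
    (secondSmallestSingularValue (toComplex B - z • (1 : Matrix (Fin n) (Fin n) ℂ)) *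
      (star y ⬝ᵥ x).re ^ 2)

end

/-! Write f(ε) for the structured pseudospectral abscissa, r₀ for the stability radius, s = y*x, and
σ for the second smallest singular value of A + Δ_opt - λI. The bound splits into an outer and an
inner estimate.

Outer estimate. The function f is nondecreasing, f(r₀) = 0, and f grows at least linearly near r₀.
Indeed, a worst-case perturbation of energy r₀ maximizes the linear functional given by its own M,
so regularity supplies an unsaturated entry with m_ij ≠ 0. When the energy grows by t, this entry
may move by t in the direction of the sign of m_ij, which shifts the simple rightmost eigenvalue to
the right at rate |m_ij|/s. Hence |ε - r₀| ≤ |f(ε)|/γ near r₀, and by monotonicity a small |f(ε)|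
forces ε to be near r₀ (`exists_mul_abs_sub_le_abs_pseudoAbscissa`). Since |α_k| ≤ α_tol at
termination, what remains is |α_k - f(ε_k)|.

Inner estimate. The last pass of the fixed-point iteration contracts towards Δ_opt. Its output
maximizes the functional given by the current M̃ (`LinearAlgReturns.isLinearOptimizer`), and Δ_opt
maximizes the one given by M (`IsWorstCase.isLinearOptimizer`), so their distance is at most c ε ‖M̃
- M‖. Perturbation theory bounds ‖M̃ - M‖ by 4√n/(σ s²) times the previous distance
(`IsRPPair.perturbation`). The product of the two factors is r. With the stopping criterion, the
final distance is at most r/(1-r) ε_tol, and the eigenvalue error at most 2/s times that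
(`InnerTrace.IsRun.error_bound`).

Uniformity. The condition r < 1 bounds σ s² from below and σ is bounded above, so s is bounded below
by a constant that depends only on the data. The neighbourhoods in which all this holds come from
compactness: along an ultrafilter, worst-case perturbations, eigenvalues and eigenvectors converge,
and regularity is applied to the limit. -/

/-! ### Eigenvector perturbation for linear maps, with constants given by a singular value -/

section LinearMaps

variable {V : Type*} [NormedAddCommGroup V] [InnerProductSpace ℂ V]

/-- A vector orthogonal to `y` has distance at least `s ‖w‖` from the line spanned by `x`, where
`s = ⟪y, x⟫` is real. -/
theorem mul_norm_le_norm_add_smul {x y w : V} {s : ℝ} (hx : ‖x‖ = 1) (hy : ‖y‖ = 1)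
    (hyx : inner ℂ y x = (s : ℂ)) (hw : inner ℂ y w = 0) (t : ℂ) :
    s * ‖w‖ ≤ ‖w + t • x‖ := by
  have hxy : inner ℂ x y = (s : ℂ) := by
    rw [← inner_conj_symm, hyx, Complex.conj_ofReal]
  -- As `w` is orthogonal to `y`, the vector `x` may be replaced by `x - s y`, of squared norm 1 -
  -- s²; this sharpens Cauchy-Schwarz to `h3`.
  have h1 : inner ℂ (x - (s : ℂ) • y) w = inner ℂ x w := by
    rw [inner_sub_left, inner_smul_left, hw]; simp
  have h2 : ‖x - (s : ℂ) • y‖ ^ 2 = 1 - s ^ 2 := by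
    rw [@norm_sub_sq ℂ, inner_smul_right, hxy, norm_smul, hx, hy]
    simp
    ring
  have h3 : ‖inner ℂ x w‖ ^ 2 ≤ (1 - s ^ 2) * ‖w‖ ^ 2 := by
    rw [← h1, ← h2, ← mul_pow]
    gcongr
    exact norm_inner_le_norm _ _
  have h4 : ‖w + t • x‖ ^ 2 = ‖w‖ ^ 2 + 2 * (t * inner ℂ w x).re + ‖t‖ ^ 2 := by
    rw [@norm_add_sq ℂ, inner_smul_right, norm_smul, hx]
    simp
  have h5 : -(‖t‖ * ‖inner ℂ x w‖) ≤ (t * inner ℂ w x).re := by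
    have := Complex.abs_re_le_norm (t * inner ℂ w x)
    rw [norm_mul, norm_inner_symm] at this
    exact (abs_le.1 this).1
  -- Minimizing over ‖t‖ leaves ‖w‖² - |⟪x, w⟫|², which is at least s²‖w‖² by `h3`.
  have h6 : (s * ‖w‖) ^ 2 ≤ ‖w + t • x‖ ^ 2 := by
    nlinarith [sq_nonneg (‖t‖ - ‖inner ℂ x w‖)]
  exact le_of_sq_le_sq h6 (norm_nonneg _)

/-- Perturbation of an eigenvector: here `x` and `y` are kernel vectors of `g` and of its adjoint,
and `x'` is an eigenvector of `g + E` for the eigenvalue `μ`. -/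
theorem eigenvector_perturbation {g E : V →ₗ[ℂ] V} {x y x' : V} {s σ e : ℝ} {μ : ℂ}
    (hx : ‖x‖ = 1) (hy : ‖y‖ = 1) (hs : 0 < s) (hyx : inner ℂ y x = (s : ℂ))
    (hgx : g x = 0) (hgy : ∀ v, inner ℂ y (g v) = 0)
    (hσ : ∀ v, inner ℂ x v = 0 → σ * ‖v‖ ≤ ‖g v‖) (hσ0 : 0 ≤ σ)
    (hE : ‖E x'‖ ≤ e) (hx' : g x' + E x' = μ • x') :
    s * (σ * s - ‖μ‖) * ‖x' - (inner ℂ y x' / s) • x‖ ≤ e := by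
  have hs' : (s : ℂ) ≠ 0 := by exact_mod_cast hs.ne'
  -- The oblique projection along `x` onto the complement of `y` commutes with `g`. Applied to the
  -- eigenvalue equation it gives g u = μ u - ω, free of the component along `x`.
  set u := x' - (inner ℂ y x' / s) • x with hu
  have hyu : inner ℂ y u = 0 := by
    rw [hu, inner_sub_right, inner_smul_right, hyx]; field_simp; simp
  have hgu : g u = μ • x' - E x' := by
    rw [hu, map_sub, map_smul, hgx, smul_zero, sub_zero, ← hx', add_sub_cancel_right]
  -- the projection of `E x'` along `x`
  set ω := E x' - (inner ℂ y (E x') / s) • x with hω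
  have hyω : inner ℂ y ω = 0 := by
    rw [hω, inner_sub_right, inner_smul_right, hyx]; field_simp; simp
  have hμ : μ * inner ℂ y x' = inner ℂ y (E x') := by
    have h := congrArg (inner ℂ y) hx'
    rw [inner_add_right, hgy, zero_add, inner_smul_right] at h
    exact h.symm
  have hgu' : g u = μ • u - ω := by
    rw [hgu, hu, hω, ← hμ, smul_sub, smul_smul, mul_div_assoc]
    abel
  -- The oblique projection has norm at most 1/s.
  have h1 : s * ‖ω‖ ≤ e := by
    refine (mul_norm_le_norm_add_smul hx hy hyx hyω (inner ℂ y (E x') / s)).trans ?_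
    rwa [hω, sub_add_cancel]
  -- The bound `hσ` needs a vector orthogonal to `x`: subtracting from `u` its component along `x`
  -- does not change the image under `g` and costs at most a factor `s` in norm.
  have h2 : σ * (s * ‖u‖) ≤ ‖g u‖ := by
    have h3 := mul_norm_le_norm_add_smul hx hy hyx hyu (-inner ℂ x u)
    have h4 := hσ (u + (-inner ℂ x u) • x) (by
      rw [inner_add_right, inner_smul_right, inner_self_eq_norm_sq_to_K, hx]; simp)
    rw [map_add, map_smul, hgx, smul_zero, add_zero] at h4
    exact (mul_le_mul_of_nonneg_left h3 hσ0).trans h4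
  have h3 : ‖g u‖ ≤ ‖μ‖ * ‖u‖ + ‖ω‖ := by
    rw [hgu', ← norm_smul]; exact norm_sub_le _ _
  calc s * (σ * s - ‖μ‖) * ‖u‖ = s * (σ * (s * ‖u‖) - ‖μ‖ * ‖u‖) := by ring
    _ ≤ s * ‖ω‖ := by gcongr; linarith
    _ ≤ e := h1

variable [FiniteDimensional ℂ V]

/-- On the orthogonal complement of a kernel vector, a linear map is bounded below by its second
smallest singular value. -/
theorem singularValue_mul_norm_le {n : ℕ} (hn : 2 ≤ n) (hV : Module.finrank ℂ V = n)
    (f : V →ₗ[ℂ] V) {x v : V} (hx : x ≠ 0) (hfx : f x = 0) (hv : inner ℂ x v = 0) :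
    f.singularValues (n - 2) * ‖v‖ ≤ ‖f v‖ := by
  set σ := f.singularValues (n - 2) with hσ
  have hσ0 : 0 ≤ σ := f.singularValues_nonneg _
  rcases hσ0.eq_or_lt with h0 | h0
  · rw [← h0, zero_mul]; exact norm_nonneg _
  let hT := f.isSymmetric_adjoint_comp_self
  let b := hT.eigenvectorBasis hV
  have hb : ∀ i w, inner ℂ (b i) ((f.adjoint ∘ₗ f) w) = hT.eigenvalues hV i * inner ℂ (b i) w := by
    intro i w
    rw [← hT, hT.apply_eigenvectorBasis, inner_smul_left]
    simp [b]
  have he : ∀ i : Fin n, (i : ℕ) ≤ n - 2 → σ ^ 2 ≤ hT.eigenvalues hV i := by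
    intro i hi
    rw [← f.sq_singularValues_fin hV i]
    exact pow_le_pow_left₀ hσ0 (f.singularValues_antitone hi) 2
  -- A kernel vector has no component along eigenvectors of f*f with positive eigenvalue, so `x`
  -- spans the last basis direction and `v` has no component there.
  have hbx : ∀ i : Fin n, (i : ℕ) ≤ n - 2 → inner ℂ (b i) x = 0 := by
    intro i hi
    have h1 := hb i x
    rw [LinearMap.comp_apply, hfx, map_zero, inner_zero_right] at h1
    rcases mul_eq_zero.1 h1.symm with h2 | h2
    · have := he i hi
      rw [Complex.ofReal_eq_zero.1 h2] at this
      nlinarith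
    · exact h2
  let j : Fin n := ⟨n - 1, by omega⟩
  have hij : ∀ i : Fin n, i ≠ j → (i : ℕ) ≤ n - 2 := by
    intro i hi
    have : (i : ℕ) ≠ n - 1 := fun h => hi (Fin.ext h)
    have := i.2
    omega
  have hxj : x = inner ℂ (b j) x • b j := by
    conv_lhs => rw [← b.sum_repr' x]
    rw [Finset.sum_eq_single j]
    · intro i _ hi
      rw [hbx i (hij i hi), zero_smul]
    · simp
  have hvj : inner ℂ (b j) v = 0 := by
    rw [hxj, inner_smul_left] at hv
    rcases mul_eq_zero.1 hv with h | h
    · rw [map_eq_zero] at h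
      rw [h, zero_smul] at hxj
      exact absurd hxj hx
    · exact h
  have h1 : (‖f v‖ ^ 2 : ℝ) = ∑ i, hT.eigenvalues hV i * ‖inner ℂ (b i) v‖ ^ 2 := by
    have h2 : ((‖f v‖ ^ 2 : ℝ) : ℂ) = inner ℂ v ((f.adjoint ∘ₗ f) v) := by
      rw [LinearMap.comp_apply, LinearMap.adjoint_inner_right, inner_self_eq_norm_sq_to_K]
      simp
    rw [← b.sum_inner_mul_inner] at h2
    have h3 : ∀ i, inner ℂ v (b i) * inner ℂ (b i) ((f.adjoint ∘ₗ f) v) =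
        ((hT.eigenvalues hV i * ‖inner ℂ (b i) v‖ ^ 2 : ℝ) : ℂ) := by
      intro i
      rw [hb, mul_left_comm, ← inner_conj_symm v (b i), Complex.conj_mul']
      push_cast
      rfl
    simp_rw [h3] at h2
    exact_mod_cast h2
  have h2 : σ ^ 2 * ‖v‖ ^ 2 ≤ ‖f v‖ ^ 2 := by
    rw [h1, ← b.sum_sq_norm_inner_right v, Finset.mul_sum]
    refine Finset.sum_le_sum fun i _ => ?_
    by_cases hi : i = j
    · rw [hi, hvj]; simp
    · exact mul_le_mul_of_nonneg_right (he i (hij i hi)) (by positivity)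
  rw [← mul_pow] at h2
  exact le_of_sq_le_sq h2 (norm_nonneg _)

/-- The version of `singularValue_mul_norm_le` for the adjoint. -/
theorem singularValue_mul_norm_le_adjoint {n : ℕ} (hn : 2 ≤ n) (hV : Module.finrank ℂ V = n)
    (f : V →ₗ[ℂ] V) {x y v : V} (hx : ‖x‖ = 1) (hfx : f x = 0) (hy : y ≠ 0)
    (hfy : f.adjoint y = 0) (hv : inner ℂ y v = 0) :
    f.singularValues (n - 2) * ‖v‖ ≤ ‖f.adjoint v‖ := by
  set σ := f.singularValues (n - 2) with hσ
  have hσ0 : 0 ≤ σ := f.singularValues_nonneg _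
  rcases hσ0.eq_or_lt with h0 | h0
  · rw [← h0, zero_mul]; exact norm_nonneg _
  -- A positive σ makes the rank at least n - 1, so the range is all of the complement of `y`. Thus
  -- `v = f p` with `p` orthogonal to `x`, and duality transfers the bound: ‖v‖² = ⟪f* v, p⟫ ≤ ‖f*
  -- v‖ ‖p‖, where σ‖p‖ ≤ ‖v‖.
  have hr : n - 2 < Module.finrank ℂ f.range := f.singularValues_pos_iff_lt_finrank_range.1 h0
  have hle : f.range ≤ (ℂ ∙ y)ᗮ := by
    rintro _ ⟨w, rfl⟩
    rw [Submodule.mem_orthogonal_singleton_iff_inner_right, ← LinearMap.adjoint_inner_left, hfy,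
      inner_zero_left]
  have : Fact (Module.finrank ℂ V = (n - 1) + 1) := ⟨by omega⟩
  have hfin := Submodule.finrank_orthogonal_span_singleton (𝕜 := ℂ) (n := n - 1) hy
  have heq : f.range = (ℂ ∙ y)ᗮ := Submodule.eq_of_le_of_finrank_le hle (by omega)
  have hvr : v ∈ f.range := by
    rw [heq, Submodule.mem_orthogonal_singleton_iff_inner_right, hv]
  obtain ⟨p₀, hp₀⟩ := hvr
  set p := p₀ - inner ℂ x p₀ • x with hp
  have hfp : f p = v := by rw [hp, map_sub, map_smul, hfx, smul_zero, sub_zero, hp₀]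
  have hxp : inner ℂ x p = 0 := by
    rw [hp, inner_sub_right, inner_smul_right, inner_self_eq_norm_sq_to_K, hx]; simp
  have hx0 : x ≠ 0 := by rintro rfl; simp at hx
  have h1 := singularValue_mul_norm_le hn hV f hx0 hfx hxp
  rw [hfp, ← hσ] at h1
  have h2 : ‖v‖ ^ 2 ≤ ‖f.adjoint v‖ * ‖p‖ := by
    have h3 : ((‖v‖ ^ 2 : ℝ) : ℂ) = inner ℂ (f.adjoint v) p := by
      rw [LinearMap.adjoint_inner_left, hfp, inner_self_eq_norm_sq_to_K]; simp
    have h4 := norm_inner_le_norm (𝕜 := ℂ) (f.adjoint v) p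
    rwa [← h3, Complex.norm_real, Real.norm_of_nonneg (by positivity)] at h4
  rcases (norm_nonneg v).eq_or_lt with hv0 | hv0
  · rw [← hv0, mul_zero]; exact norm_nonneg _
  · have h3 : σ * ‖v‖ * ‖v‖ ≤ ‖f.adjoint v‖ * ‖v‖ := by
      calc σ * ‖v‖ * ‖v‖ = σ * ‖v‖ ^ 2 := by ring
        _ ≤ σ * (‖f.adjoint v‖ * ‖p‖) := by gcongr
        _ = ‖f.adjoint v‖ * (σ * ‖p‖) := by ring
        _ ≤ ‖f.adjoint v‖ * ‖v‖ := by gcongr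
    exact le_of_mul_le_mul_right h3 hv0

end LinearMaps

/-! ### The normalized rank-one matrix `y x*` -/

section RankOne

variable {n : ℕ}

/-- The rank-one matrix `y x*`. -/
noncomputable def outer (y x : EuclideanSpace ℂ (Fin n)) : Matrix (Fin n) (Fin n) ℂ :=
  Matrix.of fun i j => y i * star (x j)

theorem norm_outer (y x : EuclideanSpace ℂ (Fin n)) : ‖outer y x‖ = ‖y‖ * ‖x‖ := by
  rw [Matrix.frobenius_norm_def, EuclideanSpace.norm_eq, EuclideanSpace.norm_eq,
    ← Real.sqrt_mul (by positivity), Finset.sum_mul_sum, Real.sqrt_eq_rpow]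
  simp [outer, mul_pow]

/-- Perturbation of `y x*`: the case where `y'` and `x'` are multiples of `y` and `x` plus small
terms, orthogonal to `x` and `y` respectively. -/
theorem norm_outer_sub_le {x y x' y' u v : EuclideanSpace ℂ (Fin n)} {a b : ℂ} {s s' ρ : ℝ}
    (hx : ‖x‖ = 1) (hy : ‖y‖ = 1) (hx' : ‖x'‖ = 1) (hy' : ‖y'‖ = 1) (hs : 0 < s) (hs' : 0 < s')
    (hyx : inner ℂ y x = (s : ℂ)) (hyx' : inner ℂ y' x' = (s' : ℂ))
    (hu : x' = a • x + u) (hv : y' = b • y + v) (hyu : inner ℂ y u = 0) (hxv : inner ℂ x v = 0)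
    (hρu : ‖u‖ ≤ ρ) (hρv : ‖v‖ ≤ ρ) :
    ‖outer y' x' - outer y x‖ ≤ 2 * (2 * ρ + (3 + 1 / s) * ρ ^ 2) := by
  have hρ : 0 ≤ ρ := (norm_nonneg _).trans hρu
  have hsC : (s : ℂ) ≠ 0 := by exact_mod_cast hs.ne'
  have ha : ‖a‖ ≤ 1 + ρ := by
    have h : a • x = x' - u := by rw [hu]; abel
    calc ‖a‖ = ‖a • x‖ := by rw [norm_smul, hx, mul_one]
      _ ≤ ‖x'‖ + ‖u‖ := by rw [h]; exact norm_sub_le _ _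
      _ ≤ 1 + ρ := by rw [hx']; gcongr
  have hb : ‖b‖ ≤ 1 + ρ := by
    have h : b • y = y' - v := by rw [hv]; abel
    calc ‖b‖ = ‖b • y‖ := by rw [norm_smul, hy, mul_one]
      _ ≤ ‖y'‖ + ‖v‖ := by rw [h]; exact norm_sub_le _ _
      _ ≤ 1 + ρ := by rw [hy']; gcongr
  have hvx : inner ℂ v x = 0 := by rw [← inner_conj_symm, hxv, map_zero]
  have hss : (s' : ℂ) = star b * a * s + inner ℂ v u := by
    rw [← hyx', hu, hv, inner_add_left, inner_add_right, inner_add_right, inner_smul_left,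
      inner_smul_left, inner_smul_right, inner_smul_right, hyx, hyu, hvx]
    simp
    ring
  have hss' : (s' : ℂ) = b * star a * s + inner ℂ u v := by
    have h := congrArg star hss
    simpa [inner_conj_symm] using h
  -- The eigenvectors are only determined up to phases, so `a` and `b` need not be near 1. The
  -- correction by ⟪u, v⟫/s makes the coefficient of `outer y x` in `outer y' x'` equal to s'/s,
  -- which RP-compatibility makes real and positive.
  set w := outer v (a • x) + outer (b • y) u + outer v u - (inner ℂ u v / s) • outer y x with hw
  have hdecomp : outer y' x' = ((s' / s : ℝ) : ℂ) • outer y x + w := by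
    have hba : ((s' / s : ℝ) : ℂ) = b * star a + inner ℂ u v / s := by
      push_cast
      rw [hss']
      field_simp
    rw [hba, hw, hu, hv]
    ext i j
    simp [outer]
    ring
  have hwn : ‖w‖ ≤ 2 * ρ + (3 + 1 / s) * ρ ^ 2 := by
    have h1 : ‖inner ℂ u v‖ ≤ ρ * ρ :=
      (norm_inner_le_norm _ _).trans (by gcongr)
    calc ‖w‖ ≤ ‖outer v (a • x)‖ + ‖outer (b • y) u‖ + ‖outer v u‖
          + ‖(inner ℂ u v / s) • outer y x‖ := by
            refine (norm_sub_le _ _).trans ?_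
            gcongr
            exact norm_add₃_le
      _ ≤ ρ * (1 + ρ) + (1 + ρ) * ρ + ρ * ρ + (ρ * ρ) / s := by
            simp only [norm_outer, norm_smul, norm_div, hx, hy, Complex.norm_real,
              Real.norm_of_nonneg hs.le, mul_one]
            gcongr
      _ = 2 * ρ + (3 + 1 / s) * ρ ^ 2 := by ring
  have hn1 : ‖outer y x‖ = 1 := by rw [norm_outer, hx, hy, mul_one]
  have hn2 : ‖outer y' x'‖ = 1 := by rw [norm_outer, hx', hy', mul_one]
  -- Both rank-one matrices have norm one, so a positive coefficient must be within ‖w‖ of 1. This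
  -- accounts for the factor 2 in the result.
  have h1 : |s' / s - 1| ≤ ‖w‖ := by
    have h := abs_norm_sub_norm_le (((s' / s : ℝ) : ℂ) • outer y x) (outer y' x')
    rw [norm_smul, hn1, hn2, Complex.norm_real, Real.norm_of_nonneg (by positivity), mul_one] at h
    rwa [hdecomp, sub_add_cancel_left, norm_neg] at h
  calc ‖outer y' x' - outer y x‖ = ‖((s' / s - 1 : ℝ) : ℂ) • outer y x + w‖ := by
        rw [hdecomp]; congr 1; push_cast; rw [sub_smul, one_smul]; abel
    _ ≤ |s' / s - 1| + ‖w‖ := by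
        refine (norm_add_le _ _).trans ?_
        rw [norm_smul, hn1, mul_one, Complex.norm_real, Real.norm_eq_abs]
    _ ≤ 2 * (2 * ρ + (3 + 1 / s) * ρ ^ 2) := by linarith

end RankOne

/-! ### Lipschitz bounds for a simple eigenvalue and its normalized eigenvectors -/

section Matrices

variable {n : ℕ}

theorem norm_mulVec_le (B : Matrix (Fin n) (Fin n) ℂ) (v : EuclideanSpace ℂ (Fin n)) :
    ‖Matrix.toEuclideanLin B v‖ ≤ ‖B‖ * ‖v‖ := by
  have h := Matrix.frobenius_norm_mul B (Matrix.replicateCol Unit v.ofLp)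
  rw [← Matrix.replicateCol_mulVec, Matrix.frobenius_norm_replicateCol,
    Matrix.frobenius_norm_replicateCol] at h
  exact h

theorem norm_toComplex (B : Matrix (Fin n) (Fin n) ℝ) : ‖toComplex B‖ = ‖B‖ :=
  Matrix.frobenius_norm_map_eq B _ fun a => Complex.norm_real a

theorem toComplex_add (B D : Matrix (Fin n) (Fin n) ℝ) :
    toComplex (B + D) = toComplex B + toComplex D := by
  ext i j; simp [toComplex]

theorem toComplex_sub (B D : Matrix (Fin n) (Fin n) ℝ) :
    toComplex (B - D) = toComplex B - toComplex D := by
  ext i j; simp [toComplex]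

theorem toComplex_smul (t : ℝ) (D : Matrix (Fin n) (Fin n) ℝ) :
    toComplex (t • D) = (t : ℂ) • toComplex D := by
  ext i j; simp [toComplex]

theorem continuous_toComplex :
    Continuous (toComplex : Matrix (Fin n) (Fin n) ℝ → Matrix (Fin n) (Fin n) ℂ) :=
  continuous_id.matrix_map Complex.continuous_ofReal

/-- Unit right and left
eigenvectors `x`, `y` of a complex matrix for the eigenvalue `z`. -/
structure IsEigenPair (B : Matrix (Fin n) (Fin n) ℂ) (z : ℂ) (x y : EuclideanSpace ℂ (Fin n)) :
    Prop where
  right : Matrix.toEuclideanLin B x = z • x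
  left : Matrix.toEuclideanLin Bᴴ y = star z • y
  unit_right : ‖x‖ = 1
  unit_left : ‖y‖ = 1

theorem inner_toEuclideanLin_conjTranspose (B : Matrix (Fin n) (Fin n) ℂ)
    (v w : EuclideanSpace ℂ (Fin n)) :
    inner ℂ (Matrix.toEuclideanLin Bᴴ v) w = inner ℂ v (Matrix.toEuclideanLin B w) := by
  rw [Matrix.toEuclideanLin_conjTranspose_eq_adjoint, LinearMap.adjoint_inner_left]

theorem IsEigenPair.inner_left {B : Matrix (Fin n) (Fin n) ℂ} {z : ℂ}
    {x y : EuclideanSpace ℂ (Fin n)} (h : IsEigenPair B z x y) (v : EuclideanSpace ℂ (Fin n)) :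
    inner ℂ y (Matrix.toEuclideanLin B v) = z * inner ℂ y v := by
  rw [← inner_toEuclideanLin_conjTranspose, h.left, inner_smul_left]; simp

theorem inner_toLp (x y : Fin n → ℂ) :
    inner ℂ (WithLp.toLp 2 y : EuclideanSpace ℂ (Fin n)) (WithLp.toLp 2 x) = star y ⬝ᵥ x := by
  rw [EuclideanSpace.inner_eq_star_dotProduct, dotProduct_comm]

theorem norm_toLp_eq_one_iff (x : Fin n → ℂ) :
    ‖(WithLp.toLp 2 x : EuclideanSpace ℂ (Fin n))‖ = 1 ↔ star x ⬝ᵥ x = 1 := by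
  rw [← inner_toLp, inner_self_eq_norm_sq_to_K]
  constructor
  · intro h; rw [h]; simp
  · intro h
    have h' : ‖(WithLp.toLp 2 x : EuclideanSpace ℂ (Fin n))‖ ^ 2 = 1 :=
      Complex.ofReal_injective (by simpa using h)
    exact (pow_eq_one_iff_of_nonneg (norm_nonneg _) two_ne_zero).1 h'

theorem isRPPair_iff {B : Matrix (Fin n) (Fin n) ℝ} {z : ℂ} {x y : Fin n → ℂ} :
    IsRPPair B z x y ↔
      IsEigenPair (toComplex B) z (WithLp.toLp 2 x) (WithLp.toLp 2 y) ∧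
        0 < (star y ⬝ᵥ x).re ∧ (star y ⬝ᵥ x).im = 0 := by
  have key : star y ᵥ* toComplex B = z • star y ↔
      Matrix.toEuclideanLin (toComplex B)ᴴ (WithLp.toLp 2 y) =
        star z • (WithLp.toLp 2 y : EuclideanSpace ℂ (Fin n)) := by
    rw [← WithLp.toLp_smul, Matrix.toLpLin_toLp, (WithLp.toLp_injective 2).eq_iff,
      ← star_inj, Matrix.star_vecMul, star_star]
    simp
  constructor
  · intro h
    refine ⟨⟨?_, key.1 h.left, (norm_toLp_eq_one_iff x).2 h.unit_right,
      (norm_toLp_eq_one_iff y).2 h.unit_left⟩, h.pos, h.real⟩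
    rw [Matrix.toLpLin_toLp]
    exact congrArg _ h.right
  · rintro ⟨h, hpos, hreal⟩
    refine ⟨?_, key.2 h.left, (norm_toLp_eq_one_iff x).1 h.unit_right,
      (norm_toLp_eq_one_iff y).1 h.unit_left, hreal, hpos⟩
    have h1 := h.right
    rw [Matrix.toLpLin_toLp] at h1
    exact WithLp.toLp_injective 2 h1

theorem IsRPPair.inner_eq {B : Matrix (Fin n) (Fin n) ℝ} {z : ℂ} {x y : Fin n → ℂ}
    (h : IsRPPair B z x y) :
    inner ℂ (WithLp.toLp 2 y : EuclideanSpace ℂ (Fin n)) (WithLp.toLp 2 x) =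
      (((star y ⬝ᵥ x).re : ℝ) : ℂ) := by
  rw [inner_toLp]
  exact Complex.ext rfl h.real

theorem norm_gradMatrix_sub_le (x y x' y' : Fin n → ℂ) :
    ‖gradMatrix x' y' - gradMatrix x y‖ ≤
      ‖outer (WithLp.toLp 2 y') (WithLp.toLp 2 x') - outer (WithLp.toLp 2 y) (WithLp.toLp 2 x)‖ := by
  rw [Matrix.frobenius_norm_def, Matrix.frobenius_norm_def]
  gcongr with i _ j _
  have := Complex.abs_re_le_norm (y' i * star (x' j) - y i * star (x j))
  simpa [gradMatrix, outer] using this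

theorem IsRPPair.norm_gradMatrix_le {B : Matrix (Fin n) (Fin n) ℝ} {z : ℂ} {x y : Fin n → ℂ}
    (h : IsRPPair B z x y) : ‖gradMatrix x y‖ ≤ 1 := by
  have h1 := norm_gradMatrix_sub_le 0 0 x y
  have h2 := (isRPPair_iff.1 h).1
  have h3 : gradMatrix (0 : Fin n → ℂ) 0 = 0 := by ext i j; simp [gradMatrix]
  have h4 : outer (WithLp.toLp 2 (0 : Fin n → ℂ)) (WithLp.toLp 2 0) = 0 := by
    ext i j; simp [outer]
  rwa [h3, h4, sub_zero, sub_zero, norm_outer, h2.unit_left, h2.unit_right, mul_one] at h1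

/-- The perturbation of an eigenvalue. -/
theorem eigenvalue_sub_mul_inner {B B' : Matrix (Fin n) (Fin n) ℂ} {z z' : ℂ}
    {x' y : EuclideanSpace ℂ (Fin n)} (hx' : Matrix.toEuclideanLin B' x' = z' • x')
    (hy : ∀ v, inner ℂ y (Matrix.toEuclideanLin B v) = z * inner ℂ y v) :
    (z' - z) * inner ℂ y x' = inner ℂ y (Matrix.toEuclideanLin (B' - B) x') := by
  rw [map_sub, LinearMap.sub_apply, inner_sub_right, hy, hx', inner_smul_right]
  ring

/-- The perturbation of a simple eigenvalue and of the normalized matrix `y x*`. -/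
theorem IsEigenPair.perturbation (hn : 2 ≤ n) {B B' : Matrix (Fin n) (Fin n) ℂ} {z z' : ℂ}
    {x y x' y' : EuclideanSpace ℂ (Fin n)} {s s' : ℝ}
    (h : IsEigenPair B z x y) (h' : IsEigenPair B' z' x' y') (hs : 0 < s) (hs' : 0 < s')
    (hyx : inner ℂ y x = (s : ℂ)) (hyx' : inner ℂ y' x' = (s' : ℂ))
    (hσ : 0 < secondSmallestSingularValue (B - z • (1 : Matrix (Fin n) (Fin n) ℂ)))
    (hz : ‖z' - z‖ ≤
      secondSmallestSingularValue (B - z • (1 : Matrix (Fin n) (Fin n) ℂ)) * s / 10)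
    (hB : ‖B' - B‖ ≤
      secondSmallestSingularValue (B - z • (1 : Matrix (Fin n) (Fin n) ℂ)) * s ^ 3 / 25) :
    ‖z' - z‖ ≤ 2 / s * ‖B' - B‖ ∧
    ‖outer y' x' - outer y x‖ ≤
      4 * √(n : ℝ) / (secondSmallestSingularValue (B - z • (1 : Matrix (Fin n) (Fin n) ℂ)) * s ^ 2)
        * ‖B' - B‖ := by
  set σ := secondSmallestSingularValue (B - z • (1 : Matrix (Fin n) (Fin n) ℂ)) with hσdef
  set e := ‖B' - B‖ with he
  have he0 : 0 ≤ e := norm_nonneg _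
  have hs1 : s ≤ 1 := by
    have := norm_inner_le_norm (𝕜 := ℂ) y x
    rwa [hyx, h.unit_left, h.unit_right, Complex.norm_real, Real.norm_of_nonneg hs.le,
      mul_one] at this
  have hxy : inner ℂ x y = (s : ℂ) := by rw [← inner_conj_symm, hyx, Complex.conj_ofReal]
  let g := Matrix.toEuclideanLin (B - z • (1 : Matrix (Fin n) (Fin n) ℂ))
  have hg : ∀ v, g v = Matrix.toEuclideanLin B v - z • v := by
    intro v; simp [g, Matrix.toLpLin_one]
  have hgx : g x = 0 := by rw [hg, h.right, sub_self]
  have hgy : ∀ v, inner ℂ y (g v) = 0 := by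
    intro v; rw [hg, inner_sub_right, h.inner_left, inner_smul_right, sub_self]
  have hga : g.adjoint = Matrix.toEuclideanLin (Bᴴ - star z • (1 : Matrix (Fin n) (Fin n) ℂ)) := by
    rw [← Matrix.toEuclideanLin_conjTranspose_eq_adjoint]; simp
  have hgav : ∀ v, g.adjoint v = Matrix.toEuclideanLin Bᴴ v - star z • v := by
    intro v; rw [hga]; simp [Matrix.toLpLin_one]
  have hfy : g.adjoint y = 0 := by rw [hgav, h.left, sub_self]
  have hx0 : x ≠ 0 := by rintro rfl; simpa using h.unit_right
  have hy0 : y ≠ 0 := by rintro rfl; simpa using h.unit_left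
  have hV : Module.finrank ℂ (EuclideanSpace ℂ (Fin n)) = n := by simp
  have key1 := eigenvector_perturbation (g := g) (E := Matrix.toEuclideanLin (B' - B)) (x' := x')
    (σ := σ) (e := e) (μ := z' - z) h.unit_right h.unit_left hs hyx hgx hgy
    (fun v hv => singularValue_mul_norm_le hn hV g hx0 hgx hv) hσ.le
    ((norm_mulVec_le _ _).trans (by rw [h'.unit_right, mul_one]))
    (by rw [hg, map_sub, LinearMap.sub_apply, h'.right, sub_smul]; abel)
  have key2 := eigenvector_perturbation (g := g.adjoint) (E := Matrix.toEuclideanLin (B' - B)ᴴ)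
    (x' := y')
    (σ := σ) (e := e) (μ := star (z' - z)) h.unit_left h.unit_right hs hxy hfy
    (fun v => by rw [LinearMap.adjoint_inner_right, hgx, inner_zero_left])
    (fun v hv => singularValue_mul_norm_le_adjoint hn hV g h.unit_right hgx hy0 hfy hv) hσ.le
    ((norm_mulVec_le _ _).trans (by
      rw [h'.unit_left, mul_one, Matrix.frobenius_norm_conjTranspose]))
    (by
      rw [hgav, Matrix.conjTranspose_sub, map_sub, LinearMap.sub_apply, h'.left, star_sub,
        sub_smul]
      abel)
  set u := x' - (inner ℂ y x' / s) • x with hu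
  set v := y' - (inner ℂ x y' / s) • y with hv
  have hsC : (s : ℂ) ≠ 0 := by exact_mod_cast hs.ne'
  have hyu : inner ℂ y u = 0 := by
    rw [hu, inner_sub_right, inner_smul_right, hyx]; field_simp; simp
  have hxv : inner ℂ x v = 0 := by
    rw [hv, inner_sub_right, inner_smul_right, hxy]; field_simp; simp
  -- The eigenvalue shift is at most σs/10, so the factor s(σs - ‖z' - z‖) is at least (9/10)σs².
  -- The assumption on `e` then gives ρ ≤ (10/9)(s/25) = 2s/45.
  set ρ := 10 / 9 * (e / (σ * s ^ 2)) with hρ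
  have hpos : 0 < σ * s ^ 2 := by positivity
  have hbound : ∀ (t : ℝ), 0 ≤ t → s * (σ * s - ‖z' - z‖) * t ≤ e → t ≤ ρ := by
    intro t ht h1
    have h2 : 9 / 10 * (σ * s ^ 2) * t ≤ e := by
      refine le_trans ?_ h1
      have h3 : 9 / 10 * (σ * s ^ 2) ≤ s * (σ * s - ‖z' - z‖) := by nlinarith
      exact mul_le_mul_of_nonneg_right h3 ht
    rw [hρ, ← mul_div_assoc, le_div_iff₀ hpos]
    nlinarith
  have hρu := hbound _ (norm_nonneg _) key1
  have hρv := hbound _ (norm_nonneg _) (by rwa [norm_star] at key2)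
  have hρ0 : 0 ≤ ρ := (norm_nonneg _).trans hρu
  have hρs : ρ ≤ s * (2 / 45) := by
    have : e / (σ * s ^ 2) ≤ s / 25 := by
      rw [div_le_iff₀ hpos]; nlinarith
    rw [hρ]; linarith
  constructor
  · have h1 := eigenvalue_sub_mul_inner h'.right h.inner_left
    -- The remainder `u` is at most 2/45 in norm, so `x'` is mostly a multiple of `x`. The resulting
    -- |⟪y, x'⟫| ≥ s/2 is the source of the constant 2/s.
    have h2 : 1 / 2 ≤ ‖inner ℂ y x' / (s : ℂ)‖ := by
      have h3 : x' = (inner ℂ y x' / s) • x + u := by rw [hu]; abel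
      have h4 := norm_add_le ((inner ℂ y x' / (s : ℂ)) • x) u
      rw [← h3, h'.unit_right, norm_smul, h.unit_right, mul_one] at h4
      linarith
    rw [norm_div, Complex.norm_real, Real.norm_of_nonneg hs.le, le_div_iff₀ hs] at h2
    have h5 : ‖z' - z‖ * ‖inner ℂ y x'‖ ≤ e := by
      rw [← norm_mul, h1]
      refine (norm_inner_le_norm _ _).trans ?_
      rw [h.unit_left, one_mul]
      exact (norm_mulVec_le _ _).trans (by rw [h'.unit_right, mul_one])
    have h6 : ‖z' - z‖ * (1 / 2 * s) ≤ e :=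
      (mul_le_mul_of_nonneg_left h2 (norm_nonneg _)).trans h5
    rw [div_mul_eq_mul_div, le_div_iff₀ hs]
    linarith
  · have h1 := norm_outer_sub_le h.unit_right h.unit_left h'.unit_right h'.unit_left hs hs' hyx hyx'
      (u := u) (v := v) (a := inner ℂ y x' / s) (b := inner ℂ x y' / s)
      (by rw [hu]; abel) (by rw [hv]; abel) hyu hxv hρu hρv
    have h2 : (3 + 1 / s) * ρ ^ 2 ≤ 8 / 45 * ρ := by
      have h3 : (3 + 1 / s) * ρ ≤ 8 / 45 := by
        have h4 : 3 + 1 / s ≤ 4 / s := by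
          rw [le_div_iff₀ hs, add_mul, one_div, inv_mul_cancel₀ hs.ne']; linarith
        calc (3 + 1 / s) * ρ ≤ 4 / s * (s * (2 / 45)) := by gcongr
          _ = 8 / 45 := by field_simp; norm_num
      calc (3 + 1 / s) * ρ ^ 2 = (3 + 1 / s) * ρ * ρ := by ring
        _ ≤ 8 / 45 * ρ := by gcongr
    -- The bound so far is 2(2 + 8/45)(10/9) < 4.9 times e/(σs²), and n ≥ 2 makes 4√n at least 5.6.
    have h3 : 1.4 ≤ √(n : ℝ) := by
      refine Real.le_sqrt_of_sq_le ?_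
      have : (2 : ℝ) ≤ n := by exact_mod_cast hn
      norm_num
      linarith
    have h4 : 4.9 * (e / (σ * s ^ 2)) ≤ 4 * √(n : ℝ) * (e / (σ * s ^ 2)) := by
      gcongr
      linarith
    calc _ ≤ _ := h1
      _ ≤ 4.9 * (e / (σ * s ^ 2)) := by
        have : 0 ≤ e / (σ * s ^ 2) := by positivity
        linarith
      _ ≤ _ := h4
      _ = _ := by ring

end Matrices

/-! ### Continuity of eigenvalues and compactness of eigenpairs -/

section Spectrum

variable {n : ℕ}

theorem mem_spectrum_iff_exists_unit {B : Matrix (Fin n) (Fin n) ℂ} {z : ℂ} :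
    z ∈ spectrum ℂ B ↔
      ∃ x : EuclideanSpace ℂ (Fin n), ‖x‖ = 1 ∧ Matrix.toEuclideanLin B x = z • x := by
  rw [← Matrix.spectrum_toLpLin (A := B) 2, ← Module.End.hasEigenvalue_iff_mem_spectrum]
  constructor
  · intro h
    obtain ⟨v, hv⟩ := h.exists_hasEigenvector
    refine ⟨((‖v‖⁻¹ : ℝ) : ℂ) • v, ?_, ?_⟩
    · rw [norm_smul, Complex.norm_real, norm_inv, norm_norm,
        inv_mul_cancel₀ (norm_ne_zero_iff.2 hv.2)]
    · rw [map_smul, hv.apply_eq_smul, smul_comm]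
  · rintro ⟨x, hx, hBx⟩
    have hx0 : x ≠ 0 := by rintro rfl; simp at hx
    exact Module.End.hasEigenvalue_of_hasEigenvector
      ⟨Module.End.mem_eigenspace_iff.2 hBx, hx0⟩

theorem star_mem_spectrum_conjTranspose {B : Matrix (Fin n) (Fin n) ℂ} {z : ℂ}
    (h : z ∈ spectrum ℂ B) : star z ∈ spectrum ℂ Bᴴ := by
  rw [← Matrix.star_eq_conjTranspose, spectrum.map_star]
  simpa using h

theorem exists_isEigenPair {B : Matrix (Fin n) (Fin n) ℂ} {z : ℂ} (h : z ∈ spectrum ℂ B) :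
    ∃ x y, IsEigenPair B z x y := by
  obtain ⟨x, hx, hBx⟩ := mem_spectrum_iff_exists_unit.1 h
  obtain ⟨y, hy, hBy⟩ := mem_spectrum_iff_exists_unit.1 (star_mem_spectrum_conjTranspose h)
  exact ⟨x, y, hBx, hBy, hx, hy⟩

theorem IsEigenPair.mem_spectrum {B : Matrix (Fin n) (Fin n) ℂ} {z : ℂ}
    {x y : EuclideanSpace ℂ (Fin n)} (h : IsEigenPair B z x y) : z ∈ spectrum ℂ B :=
  mem_spectrum_iff_exists_unit.2 ⟨x, h.unit_right, h.right⟩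

theorem norm_le_of_mem_spectrum {B : Matrix (Fin n) (Fin n) ℂ} {z : ℂ} (h : z ∈ spectrum ℂ B) :
    ‖z‖ ≤ ‖B‖ := by
  obtain ⟨x, hx, hBx⟩ := mem_spectrum_iff_exists_unit.1 h
  have := norm_mulVec_le B x
  rwa [hBx, norm_smul, hx, mul_one, mul_one] at this

/-- The modulus of the characteristic polynomial at `z` is the product of the distances from `z` to
the n roots, hence at least the n-th power of the smallest one. -/
theorem exists_mem_spectrum_pow_le [NeZero n] (B : Matrix (Fin n) (Fin n) ℂ) (z : ℂ) :
    ∃ w ∈ spectrum ℂ B, ‖z - w‖ ^ n ≤ ‖B.charpoly.eval z‖ := by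
  have hs : B.charpoly.Splits := IsAlgClosed.splits _
  have hcard : B.charpoly.roots.card = n := by
    rw [← hs.natDegree_eq_card_roots, Matrix.charpoly_natDegree_eq_dim, Fintype.card_fin]
  have hev : ‖B.charpoly.eval z‖ = (B.charpoly.roots.map fun w => ‖z - w‖).prod := by
    rw [hs.eval_eq_prod_roots, B.charpoly_monic.leadingCoeff, one_mul]
    have h := map_multiset_prod (normHom : ℂ →*₀ ℝ) (B.charpoly.roots.map fun w => z - w)
    rw [Multiset.map_map] at h
    exact h
  have hne : B.charpoly.roots ≠ 0 := by
    intro h0; rw [h0] at hcard; exact NeZero.ne n hcard.symm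
  obtain ⟨w, hw, hmin⟩ := Finset.exists_min_image B.charpoly.roots.toFinset (fun w => ‖z - w‖)
    (by rwa [Finset.nonempty_iff_ne_empty, ne_eq, Multiset.toFinset_eq_empty])
  refine ⟨w, Matrix.mem_spectrum_of_isRoot_charpoly
    (Polynomial.isRoot_of_mem_roots (Multiset.mem_toFinset.1 hw)), ?_⟩
  have hprod : (B.charpoly.roots.map fun _ => ‖z - w‖).prod ≤
      (B.charpoly.roots.map fun v => ‖z - v‖).prod :=
    Multiset.prod_map_le_prod_map₀ _ _ (fun _ _ => norm_nonneg _)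
      fun v hv => hmin v (Multiset.mem_toFinset.2 hv)
  rwa [Multiset.map_const', Multiset.prod_replicate, hcard, ← hev] at hprod

/-- Continuity of the eigenvalues. -/
theorem exists_tendsto_mem_spectrum [NeZero n] {κ : Type*} {l : Filter κ}
    {B' : κ → Matrix (Fin n) (Fin n) ℂ} {B : Matrix (Fin n) (Fin n) ℂ} (hB : Tendsto B' l (𝓝 B))
    {z : ℂ} (hz : z ∈ spectrum ℂ B) :
    ∃ w : κ → ℂ, (∀ k, w k ∈ spectrum ℂ (B' k)) ∧ Tendsto w l (𝓝 z) := by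
  choose w hw hle using fun k => exists_mem_spectrum_pow_le (B' k) z
  refine ⟨w, hw, ?_⟩
  have h1 : Tendsto (fun k => ‖(B' k).charpoly.eval z‖) l (𝓝 0) := by
    have hc : Continuous fun C : Matrix (Fin n) (Fin n) ℂ => ‖C.charpoly.eval z‖ := by
      simp_rw [Matrix.eval_charpoly]
      fun_prop
    have := (hc.tendsto B).comp hB
    rwa [(Matrix.mem_spectrum_iff_isRoot_charpoly.1 hz).eq_zero, norm_zero] at this
  have h2 : Tendsto (fun k => ‖z - w k‖ ^ n) l (𝓝 0) :=
    squeeze_zero (fun k => by positivity) hle h1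
  have h3 : Tendsto (fun k => ‖z - w k‖) l (𝓝 0) := by
    have := h2.rpow_const (p := (n : ℝ)⁻¹) (Or.inr (by positivity))
    rw [Real.zero_rpow (inv_ne_zero (Nat.cast_ne_zero.2 (NeZero.ne n)))] at this
    refine this.congr fun k => ?_
    exact Real.pow_rpow_inv_natCast (norm_nonneg _) (NeZero.ne n)
  rw [tendsto_iff_norm_sub_tendsto_zero]
  simpa only [norm_sub_rev] using h3

/-- Ultrafilters replace successive extraction of subsequences: every bounded quantity in a
compactness argument converges along the same ultrafilter. -/
theorem Ultrafilter.exists_tendsto_of_norm_le {κ X : Type*} [NormedAddCommGroup X] [ProperSpace X]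
    (U : Ultrafilter κ) {f : κ → X} {R : ℝ} (hf : ∀ᶠ k in U, ‖f k‖ ≤ R) :
    ∃ a, Tendsto f U (𝓝 a) := by
  obtain ⟨a, _, ha⟩ := (isCompact_closedBall (0 : X) R).ultrafilter_le_nhds (U.map f)
    (by
      rw [Filter.le_principal_iff]
      exact hf.mono fun k hk => by simpa using hk)
  exact ⟨a, ha⟩

theorem continuous_toEuclideanLin_apply :
    Continuous fun p : Matrix (Fin n) (Fin n) ℂ × EuclideanSpace ℂ (Fin n) =>
      Matrix.toEuclideanLin p.1 p.2 := by
  simp_rw [Matrix.toLpLin_apply]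
  refine (PiLp.continuous_toLp 2 _).comp ?_
  exact continuous_fst.matrix_mulVec ((PiLp.continuous_ofLp 2 _).comp continuous_snd)

theorem tendsto_toEuclideanLin_apply {κ : Type*} {l : Filter κ}
    {B : κ → Matrix (Fin n) (Fin n) ℂ} {B₀ : Matrix (Fin n) (Fin n) ℂ}
    {x : κ → EuclideanSpace ℂ (Fin n)} {x₀ : EuclideanSpace ℂ (Fin n)}
    (hB : Tendsto B l (𝓝 B₀)) (hx : Tendsto x l (𝓝 x₀)) :
    Tendsto (fun k => Matrix.toEuclideanLin (B k) (x k)) l (𝓝 (Matrix.toEuclideanLin B₀ x₀)) := by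
  have h : Tendsto (fun p : Matrix (Fin n) (Fin n) ℂ × EuclideanSpace ℂ (Fin n) =>
      Matrix.toEuclideanLin p.1 p.2) (𝓝 (B₀, x₀)) (𝓝 (Matrix.toEuclideanLin B₀ x₀)) :=
    continuous_toEuclideanLin_apply.tendsto _
  have h2 : Tendsto (fun k => (B k, x k)) l (𝓝 (B₀, x₀)) := hB.prodMk_nhds hx
  have h3 := h.comp h2
  exact h3

/-- A limit of eigenvectors is an eigenvector. -/
theorem eigenvector_of_tendsto {κ : Type*} {l : Filter κ} [l.NeBot]
    {B : κ → Matrix (Fin n) (Fin n) ℂ} {B₀ : Matrix (Fin n) (Fin n) ℂ}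
    {x : κ → EuclideanSpace ℂ (Fin n)} {x₀ : EuclideanSpace ℂ (Fin n)} {z : κ → ℂ} {z₀ : ℂ}
    (hB : Tendsto B l (𝓝 B₀)) (hx : Tendsto x l (𝓝 x₀)) (hz : Tendsto z l (𝓝 z₀))
    (h : ∀ᶠ k in l, Matrix.toEuclideanLin (B k) (x k) = z k • x k) :
    Matrix.toEuclideanLin B₀ x₀ = z₀ • x₀ :=
  tendsto_nhds_unique ((tendsto_toEuclideanLin_apply hB hx).congr' h) (hz.smul hx)

theorem norm_eq_one_of_tendsto {κ X : Type*} [NormedAddCommGroup X] {l : Filter κ} [l.NeBot]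
    {x : κ → X} {x₀ : X} (hx : Tendsto x l (𝓝 x₀)) (h : ∀ᶠ k in l, ‖x k‖ = 1) : ‖x₀‖ = 1 :=
  tendsto_nhds_unique (hx.norm.congr' h) tendsto_const_nhds

theorem Ultrafilter.exists_tendsto_isEigenPair {κ : Type*} (U : Ultrafilter κ)
    {B : κ → Matrix (Fin n) (Fin n) ℂ} {B₀ : Matrix (Fin n) (Fin n) ℂ}
    {x y : κ → EuclideanSpace ℂ (Fin n)} {z : κ → ℂ} {z₀ : ℂ}
    (hB : Tendsto B U (𝓝 B₀)) (hz : Tendsto z U (𝓝 z₀))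
    (h : ∀ k, IsEigenPair (B k) (z k) (x k) (y k)) :
    ∃ x₀ y₀, Tendsto x U (𝓝 x₀) ∧ Tendsto y U (𝓝 y₀) ∧ IsEigenPair B₀ z₀ x₀ y₀ := by
  obtain ⟨x₀, hx₀⟩ := U.exists_tendsto_of_norm_le (f := x) (R := 1)
    (Eventually.of_forall fun k => (h k).unit_right.le)
  obtain ⟨y₀, hy₀⟩ := U.exists_tendsto_of_norm_le (f := y) (R := 1)
    (Eventually.of_forall fun k => (h k).unit_left.le)
  refine ⟨x₀, y₀, hx₀, hy₀, ?_, ?_, ?_, ?_⟩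
  · exact eigenvector_of_tendsto hB hx₀ hz (Eventually.of_forall fun k => (h k).right)
  · exact eigenvector_of_tendsto ((continuous_id.matrix_conjTranspose.tendsto B₀).comp hB) hy₀
      hz.star (Eventually.of_forall fun k => (h k).left)
  · exact norm_eq_one_of_tendsto hx₀ (Eventually.of_forall fun k => (h k).unit_right)
  · exact norm_eq_one_of_tendsto hy₀ (Eventually.of_forall fun k => (h k).unit_left)

theorem mem_spectrum_of_tendsto {κ : Type*} (U : Ultrafilter κ)
    {B : κ → Matrix (Fin n) (Fin n) ℂ} {B₀ : Matrix (Fin n) (Fin n) ℂ} {z : κ → ℂ} {z₀ : ℂ}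
    (hB : Tendsto B U (𝓝 B₀)) (hz : Tendsto z U (𝓝 z₀)) (h : ∀ k, z k ∈ spectrum ℂ (B k)) :
    z₀ ∈ spectrum ℂ B₀ := by
  choose x y hxy using fun k => exists_isEigenPair (h k)
  obtain ⟨x₀, y₀, _, _, h₀⟩ := U.exists_tendsto_isEigenPair hB hz hxy
  exact h₀.mem_spectrum

theorem Ultrafilter.exists_tendsto_mem_spectrum {κ : Type*} (U : Ultrafilter κ)
    {B : κ → Matrix (Fin n) (Fin n) ℂ} {B₀ : Matrix (Fin n) (Fin n) ℂ} {z : κ → ℂ}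
    (hB : Tendsto B U (𝓝 B₀)) (h : ∀ k, z k ∈ spectrum ℂ (B k)) :
    ∃ z₀ ∈ spectrum ℂ B₀, Tendsto z U (𝓝 z₀) := by
  obtain ⟨z₀, hz₀⟩ := U.exists_tendsto_of_norm_le (f := z) (R := ‖B₀‖ + 1) (by
    have h1 : ∀ᶠ k in (U : Filter κ), ‖B k‖ < ‖B₀‖ + 1 :=
      hB.norm.eventually (gt_mem_nhds (lt_add_one _))
    exact h1.mono fun k hk => (norm_le_of_mem_spectrum (h k)).trans hk.le)
  exact ⟨z₀, mem_spectrum_of_tendsto U hB hz₀ h, hz₀⟩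

end Spectrum

/-! ### Continuity of the spectral abscissa -/

section Abscissa

variable {n : ℕ}

theorem exists_isRightmost [NeZero n] (B : Matrix (Fin n) (Fin n) ℝ) : ∃ z, IsRightmost B z := by
  have hne : (spectrum ℂ (toComplex B)).Nonempty :=
    let ⟨w, hw, _⟩ := exists_mem_spectrum_pow_le (toComplex B) 0
    ⟨w, hw⟩
  obtain ⟨z, hz, hmax⟩ := Set.exists_max_image _ Complex.re
    (Matrix.finite_spectrum (toComplex B)) hne
  exact ⟨z, hz, hmax⟩

theorem IsRightmost.isGreatest {B : Matrix (Fin n) (Fin n) ℝ} {z : ℂ} (h : IsRightmost B z) :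
    IsGreatest (Complex.re '' spectrum ℂ (toComplex B)) z.re :=
  ⟨⟨z, h.1, rfl⟩, by rintro _ ⟨w, hw, rfl⟩; exact h.2 w hw⟩

theorem IsRightmost.re_eq {B : Matrix (Fin n) (Fin n) ℝ} {z : ℂ} (h : IsRightmost B z) :
    z.re = spectralAbscissa B :=
  h.isGreatest.csSup_eq.symm

theorem re_le_spectralAbscissa [NeZero n] {B : Matrix (Fin n) (Fin n) ℝ} {w : ℂ}
    (hw : w ∈ spectrum ℂ (toComplex B)) : w.re ≤ spectralAbscissa B := by
  obtain ⟨z, hz⟩ := exists_isRightmost B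
  exact hz.re_eq ▸ hz.2 w hw

theorem isRightmost_iff [NeZero n] {B : Matrix (Fin n) (Fin n) ℝ} {z : ℂ} :
    IsRightmost B z ↔ z ∈ spectrum ℂ (toComplex B) ∧ z.re = spectralAbscissa B :=
  ⟨fun h => ⟨h.1, h.re_eq⟩, fun h => ⟨h.1, fun _ hw => h.2 ▸ re_le_spectralAbscissa hw⟩⟩

/-- Upper semicontinuity holds because a limit of rightmost eigenvalues is an eigenvalue of the
limit matrix; lower semicontinuity holds because each eigenvalue of the limit is itself a limit of
eigenvalues. -/
theorem continuous_spectralAbscissa [NeZero n] :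
    Continuous (spectralAbscissa : Matrix (Fin n) (Fin n) ℝ → ℝ) := by
  rw [continuous_iff_continuousAt]
  intro B
  rw [continuousAt_iff_ultrafilter]
  intro U hU
  choose z hz using fun C : Matrix (Fin n) (Fin n) ℝ => exists_isRightmost C
  have hB : Tendsto (fun C : Matrix (Fin n) (Fin n) ℝ => toComplex C) U (𝓝 (toComplex B)) :=
    (continuous_toComplex.tendsto B).mono_left hU
  obtain ⟨z₀, hz₀, hlim⟩ := U.exists_tendsto_mem_spectrum hB fun C => (hz C).1
  obtain ⟨w, hw, hwlim⟩ := exists_tendsto_mem_spectrum hB (hz B).1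
  have h1 : Tendsto (spectralAbscissa : Matrix (Fin n) (Fin n) ℝ → ℝ) U (𝓝 z₀.re) := by
    refine Tendsto.congr (fun C => (hz C).re_eq) ?_
    exact (Complex.continuous_re.tendsto z₀).comp hlim
  have h2 : z₀.re ≤ spectralAbscissa B := re_le_spectralAbscissa hz₀
  have h3 : spectralAbscissa B ≤ z₀.re := by
    rw [← (hz B).re_eq]
    exact le_of_tendsto_of_tendsto' ((Complex.continuous_re.tendsto _).comp hwlim) h1
      fun C => re_le_spectralAbscissa (hw C)
  rwa [le_antisymm h2 h3] at h1

/-- Limits of rightmost eigenvalues are rightmost. -/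
theorem Ultrafilter.exists_tendsto_isRightmost [NeZero n] {κ : Type*} (U : Ultrafilter κ)
    {B : κ → Matrix (Fin n) (Fin n) ℝ} {B₀ : Matrix (Fin n) (Fin n) ℝ} {z : κ → ℂ}
    (hB : Tendsto B U (𝓝 B₀)) (h : ∀ k, IsRightmost (B k) (z k)) :
    ∃ z₀, IsRightmost B₀ z₀ ∧ Tendsto z U (𝓝 z₀) := by
  obtain ⟨z₀, hz₀, hlim⟩ := U.exists_tendsto_mem_spectrum
    ((continuous_toComplex.tendsto B₀).comp hB) fun k => (h k).1
  refine ⟨z₀, isRightmost_iff.2 ⟨hz₀, ?_⟩, hlim⟩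
  refine tendsto_nhds_unique ((Complex.continuous_re.tendsto z₀).comp hlim) ?_
  exact ((continuous_spectralAbscissa.tendsto B₀).comp hB).congr fun k => (h k).re_eq.symm

end Abscissa

/-! ### Complex conjugation for real matrices -/

section Conjugation

variable {n : ℕ}

theorem star_mulVec_toComplex (B : Matrix (Fin n) (Fin n) ℝ) (x : Fin n → ℂ) :
    toComplex B *ᵥ star x = star (toComplex B *ᵥ x) := by
  ext i
  simp [Matrix.mulVec, dotProduct, toComplex]

theorem star_vecMul_toComplex (B : Matrix (Fin n) (Fin n) ℝ) (x : Fin n → ℂ) :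
    star x ᵥ* toComplex B = star (x ᵥ* toComplex B) := by
  ext i
  simp [Matrix.vecMul, dotProduct, toComplex]

theorem IsRPPair.conj {B : Matrix (Fin n) (Fin n) ℝ} {z : ℂ} {x y : Fin n → ℂ}
    (h : IsRPPair B z x y) : IsRPPair B (star z) (star x) (star y) := by
  have hd : ∀ u v : Fin n → ℂ, star (star u) ⬝ᵥ star v
      = star (star u ⬝ᵥ v) := by
    intro u v; simp [dotProduct]
  refine ⟨?_, ?_, ?_, ?_, ?_, ?_⟩
  · rw [star_mulVec_toComplex, h.right, star_smul]
  · rw [star_vecMul_toComplex, h.left, star_smul]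
  · rw [hd, h.unit_right, star_one]
  · rw [hd, h.unit_left, star_one]
  · rw [hd]; simpa using h.real
  · rw [hd]; simpa using h.pos

/-- This invariance is why uniqueness of the rightmost eigenvalue up to conjugation suffices: either
member of a conjugate pair yields the same linear functional. -/
theorem gradMatrix_star (x y : Fin n → ℂ) : gradMatrix (star x) (star y) = gradMatrix x y := by
  ext i j
  simp [gradMatrix]

end Conjugation

/-! ### Feasible perturbations, the pseudospectral abscissa and the stability radius -/

namespace PerturbationSet

variable {n : ℕ} (P : PerturbationSet n)

theorem isClosed_carrier : IsClosed P.carrier := by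
  have h : P.carrier = (⋂ i, ⋂ j, {D | (i, j) ∉ P.edges → D i j = 0}) ∩
      ⋂ i, ⋂ j, {D | (i, j) ∈ P.edges →
        P.lo i j ≤ (D i j : EReal) ∧ (D i j : EReal) ≤ P.hi i j} := by
    ext D; simp [carrier]
  rw [h]
  have hc : ∀ i j, Continuous fun D : Matrix (Fin n) (Fin n) ℝ => D i j :=
    fun i j => continuous_id.matrix_elem i j
  refine (isClosed_iInter fun i => isClosed_iInter fun j => ?_).inter
    (isClosed_iInter fun i => isClosed_iInter fun j => ?_)
  · by_cases he : (i, j) ∈ P.edges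
    · simp [he]
    · simpa [he] using isClosed_eq (hc i j) continuous_const
  · by_cases he : (i, j) ∈ P.edges
    · simp only [he, true_imp_iff]
      exact (isClosed_le continuous_const (continuous_coe_real_ereal.comp (hc i j))).inter
        (isClosed_le (continuous_coe_real_ereal.comp (hc i j)) continuous_const)
    · simp [he]

theorem isCompact_feasible (ε : ℝ) : IsCompact (P.feasible ε) := by
  have h : P.feasible ε = Metric.closedBall 0 ε ∩ P.carrier := by
    ext D; simp [feasible, and_comm]
  rw [h]
  exact (isCompact_closedBall _ _).inter_right P.isClosed_carrier

theorem zero_mem_carrier : (0 : Matrix (Fin n) (Fin n) ℝ) ∈ P.carrier :=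
  ⟨fun _ _ _ => rfl, fun i j _ => ⟨by simpa using P.lo_nonpos i j, by simpa using P.hi_nonneg i j⟩⟩

theorem zero_mem_feasible {ε : ℝ} (hε : 0 ≤ ε) :
    (0 : Matrix (Fin n) (Fin n) ℝ) ∈ P.feasible ε :=
  ⟨P.zero_mem_carrier, by simpa using hε⟩

variable {P}

theorem feasible_mono {ε ε' : ℝ} (h : ε ≤ ε') : P.feasible ε ⊆ P.feasible ε' :=
  fun _ hD => ⟨hD.1, hD.2.trans h⟩

theorem convex_carrier : Convex ℝ P.carrier := by
  -- A convex combination lies between the minimum and the maximum of the two real entries, so the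
  -- possibly infinite bounds enter only through the order.
  have key : ∀ (lo hi : EReal) (a b s t : ℝ), 0 ≤ s → 0 ≤ t → s + t = 1 →
      lo ≤ (a : EReal) ∧ (a : EReal) ≤ hi → lo ≤ (b : EReal) ∧ (b : EReal) ≤ hi →
      lo ≤ ((s * a + t * b : ℝ) : EReal) ∧ ((s * a + t * b : ℝ) : EReal) ≤ hi := by
    intro lo hi a b s t hs ht hst ha hb
    obtain ⟨h1, h2⟩ : min a b ≤ s * a + t * b ∧ s * a + t * b ≤ max a b := by
      have := min_le_left a b
      have := min_le_right a b
      have := le_max_left a b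
      have := le_max_right a b
      have e : s = 1 - t := by linarith
      have e1 : s * min a b + t * min a b = min a b := by rw [← add_mul, hst, one_mul]
      have e2 : s * max a b + t * max a b = max a b := by rw [← add_mul, hst, one_mul]
      constructor
      · rw [← e1]; gcongr
      · rw [← e2]; gcongr
    constructor
    · refine le_trans ?_ (EReal.coe_le_coe_iff.2 h1)
      rcases min_choice a b with h | h <;> rw [h]
      exacts [ha.1, hb.1]
    · refine (EReal.coe_le_coe_iff.2 h2).trans ?_
      rcases max_choice a b with h | h <;> rw [h]
      exacts [ha.2, hb.2]
  intro D hD D' hD' s t hs ht hst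
  refine ⟨fun i j he => ?_, fun i j he => ?_⟩
  · simp [hD.1 i j he, hD'.1 i j he]
  · exact key _ _ _ _ s t hs ht hst (hD.2 i j he) (hD'.2 i j he)

theorem convex_feasible (ε : ℝ) : Convex ℝ (P.feasible ε) := by
  have h : P.feasible ε = P.carrier ∩ Metric.closedBall 0 ε := by
    ext D; simp [feasible]
  rw [h]
  exact convex_carrier.inter (convex_closedBall _ _)

/-- Shrinking towards 0 stays in 𝓗, which is convex and contains 0. This is the tool for comparing
different energies. -/
theorem smul_mem_feasible {ε t : ℝ} (ht0 : 0 ≤ t) (ht1 : t ≤ 1) {D : Matrix (Fin n) (Fin n) ℝ}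
    (hD : D ∈ P.feasible ε) : t • D ∈ P.feasible (t * ε) := by
  constructor
  · exact convex_carrier.smul_mem_of_zero_mem P.zero_mem_carrier hD.1 ⟨ht0, ht1⟩
  · rw [norm_smul, Real.norm_of_nonneg ht0]
    exact mul_le_mul_of_nonneg_left hD.2 ht0

theorem exists_tendsto_feasible {κ : Type*} (U : Ultrafilter κ) {ε : κ → ℝ} {r : ℝ}
    (hε : Tendsto ε U (𝓝 r)) {D : κ → Matrix (Fin n) (Fin n) ℝ}
    (hD : ∀ k, D k ∈ P.feasible (ε k)) : ∃ D₀ ∈ P.feasible r, Tendsto D U (𝓝 D₀) := by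
  obtain ⟨D₀, hD₀⟩ := Ultrafilter.exists_tendsto_of_norm_le U (f := D) (R := r + 1) (by
    have h1 : ∀ᶠ k in (U : Filter κ), ε k < r + 1 := hε.eventually (gt_mem_nhds (lt_add_one _))
    exact h1.mono fun k hk => (hD k).2.trans hk.le)
  refine ⟨D₀, ⟨?_, ?_⟩, hD₀⟩
  · exact P.isClosed_carrier.mem_of_tendsto hD₀ (Eventually.of_forall fun k => (hD k).1)
  · exact le_of_tendsto_of_tendsto' hD₀.norm hε fun k => (hD k).2

theorem stabilityRadius_nonneg {A : Matrix (Fin n) (Fin n) ℝ} :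
    0 ≤ P.stabilityRadius A :=
  Real.sInf_nonneg fun _ (hx : _ ∈ P.destabilizing A) => hx.1

theorem pseudoAbscissa_neg_of_lt {A : Matrix (Fin n) (Fin n) ℝ} {ε : ℝ} (hε : 0 ≤ ε)
    (h : ε < P.stabilityRadius A) :
    P.pseudoAbscissa A ε < 0 := by
  by_contra hcon
  exact not_lt_of_ge (csInf_le ⟨0, fun _ (hx : _ ∈ P.destabilizing A) => hx.1⟩ 
    ⟨hε, not_lt.1 hcon⟩) h

section Abscissa

variable [NeZero n] {A : Matrix (Fin n) (Fin n) ℝ}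

theorem exists_isWorstCase (P : PerturbationSet n) (A : Matrix (Fin n) (Fin n) ℝ) {ε : ℝ}
    (hε : 0 ≤ ε) : ∃ D, P.IsWorstCase A ε D := by
  obtain ⟨D, hD, hmax⟩ := (P.isCompact_feasible ε).exists_isMaxOn ⟨0, P.zero_mem_feasible hε⟩
    (f := fun D => spectralAbscissa (A + D))
    (continuous_spectralAbscissa.comp (continuous_const.add continuous_id)).continuousOn
  exact ⟨D, hD, fun D' hD' => hmax hD'⟩

theorem IsWorstCase.pseudoAbscissa_eq {ε : ℝ} {D : Matrix (Fin n) (Fin n) ℝ}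
    (h : P.IsWorstCase A ε D) : P.pseudoAbscissa A ε = spectralAbscissa (A + D) := by
  obtain ⟨z, hz⟩ := exists_isRightmost (A + D)
  have hg : IsGreatest (Complex.re '' P.pseudospectrum A ε) z.re := by
    refine ⟨⟨z, ⟨D, h.1, hz.1⟩, rfl⟩, ?_⟩
    rintro _ ⟨w, ⟨D', hD', hw⟩, rfl⟩
    rw [hz.re_eq]
    exact (re_le_spectralAbscissa hw).trans (h.2 D' hD')
  rw [← hz.re_eq]
  exact hg.csSup_eq

theorem spectralAbscissa_le_pseudoAbscissa {ε : ℝ} {D : Matrix (Fin n) (Fin n) ℝ}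
    (hD : D ∈ P.feasible ε) : spectralAbscissa (A + D) ≤ P.pseudoAbscissa A ε := by
  obtain ⟨D', hD'⟩ := P.exists_isWorstCase A ((norm_nonneg _).trans hD.2)
  rw [hD'.pseudoAbscissa_eq]
  exact hD'.2 D hD

theorem pseudoAbscissa_mono {ε ε' : ℝ} (hε : 0 ≤ ε) (h : ε ≤ ε') :
    P.pseudoAbscissa A ε ≤ P.pseudoAbscissa A ε' := by
  obtain ⟨D, hD⟩ := P.exists_isWorstCase A hε
  rw [hD.pseudoAbscissa_eq]
  exact spectralAbscissa_le_pseudoAbscissa (feasible_mono h hD.1)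

/-- Limits of worst-case perturbations are worst-case perturbations. -/
theorem exists_tendsto_isWorstCase {κ : Type*} (U : Ultrafilter κ) {ε : κ → ℝ} {r : ℝ}
    (hr : 0 < r) (hε : Tendsto ε U (𝓝 r)) {D : κ → Matrix (Fin n) (Fin n) ℝ}
    (hD : ∀ k, P.IsWorstCase A (ε k) (D k)) :
    ∃ D₀, P.IsWorstCase A r D₀ ∧ Tendsto D U (𝓝 D₀) := by
  obtain ⟨D₀, hD₀, hlim⟩ := exists_tendsto_feasible U hε fun k => (hD k).1
  refine ⟨D₀, ⟨hD₀, fun D' hD' => ?_⟩, hlim⟩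
  -- A competitor `D'` of energy `r` need not be feasible at energy `ε k`; scaled by min(1, ε_k/r)
  -- it is, and the scaled competitors converge to `D'`.
  have h1 : Tendsto (fun k => min 1 (ε k / r)) U (𝓝 1) := by
    have : Tendsto (fun k => min 1 (ε k / r)) U (𝓝 (min 1 (r / r))) :=
      tendsto_const_nhds.min (hε.div_const r)
    rwa [div_self hr.ne', min_self] at this
  have h2 : Tendsto (fun k => spectralAbscissa (A + min 1 (ε k / r) • D')) U
      (𝓝 (spectralAbscissa (A + D'))) := by
    have h3 : Tendsto (fun k => A + min 1 (ε k / r) • D') U (𝓝 (A + (1 : ℝ) • D')) :=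
      tendsto_const_nhds.add (h1.smul_const D')
    rw [one_smul] at h3
    exact (continuous_spectralAbscissa.tendsto _).comp h3
  have h4 : Tendsto (fun k => spectralAbscissa (A + D k)) U (𝓝 (spectralAbscissa (A + D₀))) :=
    (continuous_spectralAbscissa.tendsto _).comp (tendsto_const_nhds.add hlim)
  refine le_of_tendsto_of_tendsto' h2 h4 fun k => (hD k).2 _ ?_
  have hεk : 0 ≤ ε k := (norm_nonneg _).trans (hD k).1.2
  refine feasible_mono ?_ (smul_mem_feasible (le_min zero_le_one (by positivity))
    (min_le_left _ _) hD')
  calc min 1 (ε k / r) * r ≤ ε k / r * r := by gcongr; exact min_le_right _ _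
    _ = ε k := div_mul_cancel₀ _ hr.ne'

/-- The infimum is attained: worst-case perturbations for destabilizing energies decreasing to it
have a feasible limit, whose abscissa is nonnegative by continuity. -/
theorem pseudoAbscissa_stabilityRadius_nonneg (hP : (P.destabilizing A).Nonempty) :
    0 ≤ P.pseudoAbscissa A (P.stabilityRadius A) := by
  set r := P.stabilityRadius A with hr
  have hex : ∀ k : ℕ, ∃ ε ∈ P.destabilizing A, ε < r + 1 / ((k : ℝ) + 1) := fun k =>
    exists_lt_of_csInf_lt hP (lt_add_of_pos_right _ (by positivity))
  choose ε hε hlt using hex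
  have hlim : Tendsto ε atTop (𝓝 r) := by
    refine tendsto_of_tendsto_of_tendsto_of_le_of_le tendsto_const_nhds ?_
      (fun k => csInf_le ⟨0, fun _ (hx : _ ∈ P.destabilizing A) => hx.1⟩ (hε k)) (fun k => (hlt k).le)
    simpa using tendsto_const_nhds.add (tendsto_one_div_add_atTop_nhds_zero_nat (𝕜 := ℝ))
  choose D hD using fun k => P.exists_isWorstCase A (hε k).1
  let U : Ultrafilter ℕ := Ultrafilter.of atTop
  have hU : Tendsto ε U (𝓝 r) := hlim.mono_left (Ultrafilter.of_le _)
  obtain ⟨D₀, hD₀, hDlim⟩ := exists_tendsto_feasible U hU fun k => (hD k).1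
  have h4 : Tendsto (fun k => spectralAbscissa (A + D k)) U (𝓝 (spectralAbscissa (A + D₀))) :=
    (continuous_spectralAbscissa.tendsto _).comp (tendsto_const_nhds.add hDlim)
  refine le_trans ?_ (spectralAbscissa_le_pseudoAbscissa hD₀)
  refine ge_of_tendsto' h4 fun k => ?_
  rw [← (hD k).pseudoAbscissa_eq]
  exact (hε k).2

/-- At energy 0 only the zero perturbation is feasible, and `A` is Hurwitz. -/
theorem stabilityRadius_pos (hA : IsHurwitz A) (hP : (P.destabilizing A).Nonempty) :
    0 < P.stabilityRadius A := by
  refine stabilityRadius_nonneg.lt_of_ne fun h => ?_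
  have h1 := pseudoAbscissa_stabilityRadius_nonneg hP
  rw [← h] at h1
  obtain ⟨D, hD⟩ := P.exists_isWorstCase A le_rfl
  obtain ⟨z, hz⟩ := exists_isRightmost (A + D)
  have hD0 : D = 0 := norm_le_zero_iff.1 hD.1.2
  rw [hD.pseudoAbscissa_eq, ← hz.re_eq] at h1
  have := hz.1
  rw [hD0, add_zero] at this
  exact not_lt_of_ge h1 (hA z this)

/-- A worst-case perturbation, scaled by factors below 1 that tend to 1, has energy below the
stability radius and hence negative abscissa; continuity gives the upper bound 0. -/
theorem pseudoAbscissa_stabilityRadius (hA : IsHurwitz A) (hP : (P.destabilizing A).Nonempty) :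
    P.pseudoAbscissa A (P.stabilityRadius A) = 0 := by
  refine le_antisymm ?_ (pseudoAbscissa_stabilityRadius_nonneg hP)
  have hr := stabilityRadius_pos hA hP
  set r := P.stabilityRadius A with hrdef
  obtain ⟨D, hD⟩ := P.exists_isWorstCase A hr.le
  rw [hD.pseudoAbscissa_eq]
  have h1 : Tendsto (fun k : ℕ => 1 - 1 / ((k : ℝ) + 1)) atTop (𝓝 1) := by
    simpa using tendsto_const_nhds.sub (tendsto_one_div_add_atTop_nhds_zero_nat (𝕜 := ℝ))
  have h2 : Tendsto (fun k : ℕ => spectralAbscissa (A + (1 - 1 / ((k : ℝ) + 1)) • D)) atTop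
      (𝓝 (spectralAbscissa (A + D))) := by
    have h3 : Tendsto (fun k : ℕ => A + (1 - 1 / ((k : ℝ) + 1)) • D) atTop
        (𝓝 (A + (1 : ℝ) • D)) := tendsto_const_nhds.add (h1.smul_const D)
    rw [one_smul] at h3
    exact (continuous_spectralAbscissa.tendsto _).comp h3
  refine le_of_tendsto' h2 fun k => ?_
  have hk : 1 / ((k : ℝ) + 1) ≤ 1 := by
    rw [div_le_one (by positivity)]; linarith [k.cast_nonneg (α := ℝ)]
  have hk0 : 0 < 1 / ((k : ℝ) + 1) := by positivity
  refine (spectralAbscissa_le_pseudoAbscissa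
    (smul_mem_feasible (by linarith) (by linarith) hD.1)).trans
    (pseudoAbscissa_neg_of_lt (mul_nonneg (by linarith) hr.le) ?_).le
  nlinarith

end Abscissa

end PerturbationSet

/-! ### Simple eigenvalues and their first-order expansion -/

section SimpleEigenvalues

variable {n : ℕ}

theorem toEuclideanLin_sub_smul_one (B : Matrix (Fin n) (Fin n) ℂ) (z : ℂ) :
    Matrix.toEuclideanLin (B - z • (1 : Matrix (Fin n) (Fin n) ℂ)) =
      Matrix.toEuclideanLin B - z • LinearMap.id := by
  simp [Matrix.toLpLin_one]

theorem mem_ker_sub_smul_one {B : Matrix (Fin n) (Fin n) ℂ} {z : ℂ}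
    {x : EuclideanSpace ℂ (Fin n)} :
    x ∈ (Matrix.toEuclideanLin (B - z • (1 : Matrix (Fin n) (Fin n) ℂ))).ker ↔
      Matrix.toEuclideanLin B x = z • x := by
  rw [toEuclideanLin_sub_smul_one]
  simp [sub_eq_zero]

theorem secondSmallestSingularValue_nonneg (B : Matrix (Fin n) (Fin n) ℂ) :
    0 ≤ secondSmallestSingularValue B :=
  LinearMap.singularValues_nonneg _ _

/-- Positivity of this singular value means rank at least n - 1, so rank-nullity turns it into
geometric simplicity. -/
theorem secondSmallestSingularValue_pos_iff (hn : 2 ≤ n) (B : Matrix (Fin n) (Fin n) ℂ) :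
    0 < secondSmallestSingularValue B ↔
      Module.finrank ℂ (Matrix.toEuclideanLin B).ker ≤ 1 := by
  rw [secondSmallestSingularValue, LinearMap.singularValues_pos_iff_lt_finrank_range]
  have := (Matrix.toEuclideanLin B).finrank_range_add_finrank_ker
  rw [finrank_euclideanSpace_fin] at this
  omega

/-- If `σ_{n-1}(B - z I) > 0`, then the eigenvectors for `z` are multiples of each other. -/
theorem eigenvector_eq_smul (hn : 2 ≤ n) {B : Matrix (Fin n) (Fin n) ℂ} {z : ℂ}
    (hσ : 0 < secondSmallestSingularValue (B - z • (1 : Matrix (Fin n) (Fin n) ℂ)))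
    {x x' : EuclideanSpace ℂ (Fin n)} (hx0 : x ≠ 0) (hx : Matrix.toEuclideanLin B x = z • x)
    (hx' : Matrix.toEuclideanLin B x' = z • x') : ∃ c : ℂ, x' = c • x := by
  rw [secondSmallestSingularValue_pos_iff hn, finrank_le_one_iff] at hσ
  obtain ⟨v, hv⟩ := hσ
  obtain ⟨a, ha⟩ := hv ⟨x, mem_ker_sub_smul_one.2 hx⟩
  obtain ⟨b, hb⟩ := hv ⟨x', mem_ker_sub_smul_one.2 hx'⟩
  have ha' : a • (v : EuclideanSpace ℂ (Fin n)) = x := congrArg Subtype.val ha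
  have hb' : b • (v : EuclideanSpace ℂ (Fin n)) = x' := congrArg Subtype.val hb
  have ha0 : a ≠ 0 := by rintro rfl; rw [zero_smul] at ha'; exact hx0 ha'.symm
  refine ⟨b / a, ?_⟩
  rw [← hb', ← ha', smul_smul, div_mul_cancel₀ _ ha0]

theorem exists_orthogonal_eigenvectors (hn : 2 ≤ n) {B : Matrix (Fin n) (Fin n) ℂ} {z : ℂ}
    (hσ : ¬ 0 < secondSmallestSingularValue (B - z • (1 : Matrix (Fin n) (Fin n) ℂ))) :
    ∃ u v : EuclideanSpace ℂ (Fin n), ‖u‖ = 1 ∧ ‖v‖ = 1 ∧ inner ℂ u v = 0 ∧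
      Matrix.toEuclideanLin B u = z • u ∧ Matrix.toEuclideanLin B v = z • v := by
  rw [secondSmallestSingularValue_pos_iff hn, not_le] at hσ
  let b := stdOrthonormalBasis ℂ
    (Matrix.toEuclideanLin (B - z • (1 : Matrix (Fin n) (Fin n) ℂ))).ker
  let i : Fin (Module.finrank ℂ
    (Matrix.toEuclideanLin (B - z • (1 : Matrix (Fin n) (Fin n) ℂ))).ker) := ⟨0, by omega⟩
  let j : Fin (Module.finrank ℂ
    (Matrix.toEuclideanLin (B - z • (1 : Matrix (Fin n) (Fin n) ℂ))).ker) := ⟨1, by omega⟩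
  have hij : i ≠ j := by simp [i, j]
  refine ⟨b i, b j, b.norm_eq_one i, b.norm_eq_one j, b.inner_eq_zero hij,
    mem_ker_sub_smul_one.1 (b i).2, mem_ker_sub_smul_one.1 (b j).2⟩

theorem charpoly_toEuclideanLin (B : Matrix (Fin n) (Fin n) ℂ) :
    (Matrix.toEuclideanLin B).charpoly = B.charpoly := by
  change (Matrix.toLpLin 2 2 B).charpoly = _
  rw [Matrix.toLpLin_eq_toLin, Matrix.charpoly_toLin]

theorem secondSmallestSingularValue_pos (hn : 2 ≤ n) {B : Matrix (Fin n) (Fin n) ℂ} {z : ℂ}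
    (h : B.charpoly.rootMultiplicity z = 1) :
    0 < secondSmallestSingularValue (B - z • (1 : Matrix (Fin n) (Fin n) ℂ)) := by
  rw [secondSmallestSingularValue_pos_iff hn]
  have h1 := LinearMap.finrank_eigenspace_le (Matrix.toEuclideanLin B) z
  rw [charpoly_toEuclideanLin, h] at h1
  have h2 : (Matrix.toEuclideanLin (B - z • (1 : Matrix (Fin n) (Fin n) ℂ))).ker =
      Module.End.eigenspace (Matrix.toEuclideanLin B) z := by
    ext x
    rw [mem_ker_sub_smul_one, Module.End.mem_eigenspace_iff]
  rwa [h2]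

/-- Right and left eigenvectors of an algebraically simple eigenvalue are not orthogonal. -/
theorem IsEigenPair.inner_ne_zero (hn : 2 ≤ n) {B : Matrix (Fin n) (Fin n) ℂ} {z : ℂ}
    {x y : EuclideanSpace ℂ (Fin n)} (h : IsEigenPair B z x y)
    (hm : B.charpoly.rootMultiplicity z = 1) : inner ℂ y x ≠ 0 := by
  intro hyx
  have hσ := secondSmallestSingularValue_pos hn hm
  have hx0 : x ≠ 0 := by rintro rfl; simpa using h.unit_right
  have hy0 : y ≠ 0 := by rintro rfl; simpa using h.unit_left
  set g := Matrix.toEuclideanLin (B - z • (1 : Matrix (Fin n) (Fin n) ℂ)) with hg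
  have hgv : ∀ v, g v = Matrix.toEuclideanLin B v - z • v := by
    intro v; rw [hg, toEuclideanLin_sub_smul_one]; simp
  have hr : n - 2 < Module.finrank ℂ g.range := g.singularValues_pos_iff_lt_finrank_range.1 hσ
  have hle : g.range ≤ (ℂ ∙ y)ᗮ := by
    rintro _ ⟨w, rfl⟩
    rw [Submodule.mem_orthogonal_singleton_iff_inner_right, hgv, inner_sub_right, h.inner_left,
      inner_smul_right, sub_self]
  have : Fact (Module.finrank ℂ (EuclideanSpace ℂ (Fin n)) = (n - 1) + 1) :=
    ⟨by rw [finrank_euclideanSpace_fin]; omega⟩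
  have hfin := Submodule.finrank_orthogonal_span_singleton (𝕜 := ℂ) (n := n - 1) hy0
  have heq : g.range = (ℂ ∙ y)ᗮ := Submodule.eq_of_le_of_finrank_le hle (by omega)
  -- If `x` were orthogonal to `y`, it would lie in the range of `g`, and a preimage `w` would be a
  -- generalized eigenvector. Algebraic simplicity makes `w` a multiple of `x`, so x = g w = 0.
  have hxr : x ∈ g.range := by
    rw [heq, Submodule.mem_orthogonal_singleton_iff_inner_right, hyx]
  obtain ⟨w, hw⟩ := hxr
  have hfin1 := LinearMap.finrank_maxGenEigenspace_eq (Matrix.toEuclideanLin B) z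
  rw [charpoly_toEuclideanLin, hm] at hfin1
  have hgx : g x = 0 := by rw [hgv, h.right, sub_self]
  have hmem : ∀ v, g (g v) = 0 → v ∈ Module.End.maxGenEigenspace (Matrix.toEuclideanLin B) z := by
    intro v hv
    rw [Module.End.mem_maxGenEigenspace]
    refine ⟨2, ?_⟩
    have hgg : Matrix.toEuclideanLin B - z • (1 : Module.End ℂ (EuclideanSpace ℂ (Fin n))) = g := by
      rw [hg, toEuclideanLin_sub_smul_one]; rfl
    rw [hgg, pow_two]
    exact hv
  obtain ⟨c, hc⟩ := (finrank_eq_one_iff_of_nonzero'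
    (⟨x, hmem x (by rw [hgx, map_zero])⟩ :
      Module.End.maxGenEigenspace (Matrix.toEuclideanLin B) z)
    (fun h0 => hx0 (congrArg Subtype.val h0))).1 hfin1 ⟨w, hmem w (by rw [hw, hgx])⟩
  have hc' : c • x = w := congrArg Subtype.val hc
  rw [← hc', map_smul, hgx, smul_zero] at hw
  exact hx0 hw.symm

/-- Scaling a pair of eigenvectors to an RP-compatible pair. -/
theorem IsEigenPair.exists_isRPPair {B : Matrix (Fin n) (Fin n) ℝ} {z : ℂ}
    {x y : EuclideanSpace ℂ (Fin n)} (h : IsEigenPair (toComplex B) z x y)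
    (hyx : inner ℂ y x ≠ 0) :
    ∃ c : ℂ, c ≠ 0 ∧ IsRPPair B z (c • x).ofLp y.ofLp := by
  set a := inner ℂ y x with ha
  have hna : (‖a‖ : ℂ) ≠ 0 := by exact_mod_cast norm_ne_zero_iff.2 hyx
  have hinner : inner ℂ y (((‖a‖ : ℂ) / a) • x) = (‖a‖ : ℂ) := by
    rw [inner_smul_right, ← ha, div_mul_cancel₀ _ hyx]
  have hdot : star y.ofLp ⬝ᵥ (((‖a‖ : ℂ) / a) • x).ofLp = (‖a‖ : ℂ) := by
    rw [← inner_toLp, WithLp.toLp_ofLp, WithLp.toLp_ofLp, hinner]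
  refine ⟨(‖a‖ : ℂ) / a, div_ne_zero hna hyx, isRPPair_iff.2 ⟨⟨?_, ?_, ?_, ?_⟩, ?_, ?_⟩⟩
  · rw [WithLp.toLp_ofLp, map_smul, h.right, smul_comm]
  · rw [WithLp.toLp_ofLp, h.left]
  · rw [WithLp.toLp_ofLp, norm_smul, h.unit_right, norm_div, Complex.norm_real, norm_norm,
      div_self (norm_ne_zero_iff.2 hyx), mul_one]
  · rw [WithLp.toLp_ofLp, h.unit_left]
  · rw [hdot, Complex.ofReal_re]; exact norm_pos_iff.2 hyx
  · rw [hdot, Complex.ofReal_im]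

theorem re_inner_toEuclideanLin (G : Matrix (Fin n) (Fin n) ℝ) (x y : Fin n → ℂ) :
    (inner ℂ (WithLp.toLp 2 y : EuclideanSpace ℂ (Fin n))
      (Matrix.toEuclideanLin (toComplex G) (WithLp.toLp 2 x))).re =
      ∑ i, ∑ j, G i j * gradMatrix x y i j := by
  rw [Matrix.toLpLin_toLp, inner_toLp, Matrix.toLin'_apply]
  simp only [dotProduct, Matrix.mulVec, toComplex, gradMatrix, Finset.mul_sum, Complex.re_sum]
  refine Finset.sum_congr rfl fun i _ => Finset.sum_congr rfl fun j _ => ?_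
  simp
  ring

/-- First-order expansion of a simple eigenvalue, as a lower bound for the real part, uniform for
base points near `B₀`. -/
theorem Ultrafilter.eventually_exists_mem_spectrum (hn : 2 ≤ n) {κ : Type*} (U : Ultrafilter κ)
    {B : κ → Matrix (Fin n) (Fin n) ℂ} {B₀ G : Matrix (Fin n) (Fin n) ℂ} {t : κ → ℝ}
    {x y : κ → EuclideanSpace ℂ (Fin n)} {x₀ y₀ : EuclideanSpace ℂ (Fin n)} {z : κ → ℂ} {z₀ : ℂ}
    (hB : Tendsto B U (𝓝 B₀)) (ht : Tendsto t U (𝓝 0)) (ht0 : ∀ k, 0 < t k)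
    (hy : Tendsto y U (𝓝 y₀)) (h : ∀ k, IsEigenPair (B k) (z k) (x k) (y k))
    (h₀ : IsEigenPair B₀ z₀ x₀ y₀)
    (hσ : 0 < secondSmallestSingularValue (B₀ - z₀ • (1 : Matrix (Fin n) (Fin n) ℂ)))
    (hyx : inner ℂ y₀ x₀ ≠ 0) {γ : ℝ}
    (hγ : γ < (inner ℂ y₀ (Matrix.toEuclideanLin G x₀) / inner ℂ y₀ x₀).re) :
    ∀ᶠ k in U, ∃ w ∈ spectrum ℂ (B k + (t k : ℂ) • G), (z k).re + γ * t k ≤ w.re := by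
  have : NeZero n := ⟨by omega⟩
  have hB' : Tendsto (fun k => B k + (t k : ℂ) • G) U (𝓝 B₀) := by
    have h1 : Tendsto (fun k => (t k : ℂ)) U (𝓝 ((0 : ℝ) : ℂ)) :=
      (Complex.continuous_ofReal.tendsto 0).comp ht
    have h2 := hB.add (h1.smul_const G)
    rwa [Complex.ofReal_zero, zero_smul, add_zero] at h2
  obtain ⟨w, hw, hwlim⟩ := _root_.exists_tendsto_mem_spectrum hB' h₀.mem_spectrum
  choose x' y' hxy' using fun k => exists_isEigenPair (hw k)
  obtain ⟨x₁, y₁, hx₁, -, h₁⟩ := U.exists_tendsto_isEigenPair hB' hwlim hxy'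
  have hx₀0 : x₀ ≠ 0 := by rintro rfl; simpa using h₀.unit_right
  obtain ⟨c, hc⟩ := eigenvector_eq_smul hn hσ hx₀0 h₀.right h₁.right
  have hc0 : c ≠ 0 := by
    rintro rfl; have := h₁.unit_right; rw [hc, zero_smul, norm_zero] at this; norm_num at this
  have hyx₁ : inner ℂ y₀ x₁ ≠ 0 := by
    rw [hc, inner_smul_right]; exact mul_ne_zero hc0 hyx
  -- The perturbed eigenvectors converge only to some multiple of `x₀`, but the quotient that gives
  -- the derivative does not see the scaling.
  have hratio : inner ℂ y₀ (Matrix.toEuclideanLin G x₁) / inner ℂ y₀ x₁ =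
      inner ℂ y₀ (Matrix.toEuclideanLin G x₀) / inner ℂ y₀ x₀ := by
    rw [hc, map_smul, inner_smul_right, inner_smul_right, mul_div_mul_left _ _ hc0]
  have hden : Tendsto (fun k => inner ℂ (y k) (x' k)) U (𝓝 (inner ℂ y₀ x₁)) := hy.inner hx₁
  have hnum : Tendsto (fun k => inner ℂ (y k) (Matrix.toEuclideanLin G (x' k))) U
      (𝓝 (inner ℂ y₀ (Matrix.toEuclideanLin G x₁))) :=
    hy.inner (tendsto_toEuclideanLin_apply tendsto_const_nhds hx₁)
  have hq := (Complex.continuous_re.tendsto _).comp (hnum.div hden hyx₁)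
  rw [hratio] at hq
  filter_upwards [hq.eventually (lt_mem_nhds hγ), hden.eventually_ne hyx₁] with k hk hk0
  refine ⟨w k, hw k, ?_⟩
  -- This identity is exact: it pairs the left eigenvector of `B k` with the right eigenvector of
  -- the perturbed matrix, so no differentiability of the eigenvalue is needed.
  have h1 := eigenvalue_sub_mul_inner (hxy' k).right (h k).inner_left
  rw [add_sub_cancel_left, map_smul, LinearMap.smul_apply, inner_smul_right] at h1
  have h2 : w k - z k = (t k : ℂ) *
      (inner ℂ (y k) (Matrix.toEuclideanLin G (x' k)) / inner ℂ (y k) (x' k)) := by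
    rw [← mul_div_assoc, eq_div_iff hk0, h1]
  have h3 := congrArg Complex.re h2
  rw [Complex.re_ofReal_mul, Complex.sub_re] at h3
  have h4 : γ * t k ≤ t k *
      (inner ℂ (y k) (Matrix.toEuclideanLin G (x' k)) / inner ℂ (y k) (x' k)).re := by
    rw [mul_comm]; exact mul_le_mul_of_nonneg_left hk.le (ht0 k).le
  linarith

end SimpleEigenvalues

/-! ### First-order optimality, and consequences of regularity at nearby energies -/

namespace PerturbationSet

variable {n : ℕ} {P : PerturbationSet n} {A : Matrix (Fin n) (Fin n) ℝ}

/-- First-order optimality condition for worst-case perturbations. -/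
theorem IsWorstCase.isLinearOptimizer (hn : 2 ≤ n) {ε : ℝ} {D : Matrix (Fin n) (Fin n) ℝ}
    (hD : P.IsWorstCase A ε D) {z : ℂ} {x y : Fin n → ℂ} (hz : IsRightmost (A + D) z)
    (hxy : IsRPPair (A + D) z x y)
    (hσ : 0 < secondSmallestSingularValue
      (toComplex (A + D) - z • (1 : Matrix (Fin n) (Fin n) ℂ))) :
    P.IsLinearOptimizer ε (gradMatrix x y) D := by
  have : NeZero n := ⟨by omega⟩
  refine ⟨hD.1, fun D' hD' => ?_⟩
  by_contra hcon
  rw [not_le] at hcon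
  have hpair := (isRPPair_iff.1 hxy).1
  have hpos : 0 < ∑ i, ∑ j, (D' - D) i j * gradMatrix x y i j := by
    simp only [Matrix.sub_apply, sub_mul, Finset.sum_sub_distrib]
    linarith
  set g := ∑ i, ∑ j, (D' - D) i j * gradMatrix x y i j with hg
  -- Half of the derivative in the direction `D' - D` leaves room for the strict inequality in the
  -- expansion; moving along the segment then beats the worst case.
  have hratio : g / (star y ⬝ᵥ x).re / 2 < (inner ℂ (WithLp.toLp 2 y : EuclideanSpace ℂ (Fin n))
      (Matrix.toEuclideanLin (toComplex (D' - D)) (WithLp.toLp 2 x)) /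
      inner ℂ (WithLp.toLp 2 y : EuclideanSpace ℂ (Fin n)) (WithLp.toLp 2 x)).re := by
    rw [hxy.inner_eq, Complex.div_ofReal_re, re_inner_toEuclideanLin, ← hg]
    exact half_lt_self (div_pos hpos hxy.pos)
  have ht : Tendsto (fun k : ℕ => 1 / ((k : ℝ) + 1)) (Ultrafilter.of atTop : Ultrafilter ℕ)
      (𝓝 0) := tendsto_one_div_add_atTop_nhds_zero_nat.mono_left (Ultrafilter.of_le _)
  have hev := Ultrafilter.eventually_exists_mem_spectrum hn (Ultrafilter.of (atTop : Filter ℕ))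
    (B := fun _ => toComplex (A + D)) (z := fun _ => z) (x := fun _ => WithLp.toLp 2 x)
    (y := fun _ => WithLp.toLp 2 y) tendsto_const_nhds ht (fun k => by positivity)
    tendsto_const_nhds (fun _ => hpair) hpair hσ
    (by rw [hxy.inner_eq]; exact_mod_cast hxy.pos.ne') hratio
  obtain ⟨k, w, hw, hle⟩ := hev.exists
  have hk0 : 0 < 1 / ((k : ℝ) + 1) := by positivity
  have hk1 : 1 / ((k : ℝ) + 1) ≤ 1 := by
    rw [div_le_one (by positivity)]; linarith [k.cast_nonneg (α := ℝ)]
  rw [← toComplex_smul, ← toComplex_add, add_assoc] at hw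
  have hfeas : D + (1 / ((k : ℝ) + 1)) • (D' - D) ∈ P.feasible ε :=
    (convex_feasible ε).add_smul_sub_mem hD.1 hD' ⟨hk0.le, hk1⟩
  have h1 := (re_le_spectralAbscissa hw).trans (hD.2 _ hfeas)
  rw [← hz.re_eq] at h1
  have h2 : 0 < g / (star y ⬝ᵥ x).re / 2 * (1 / ((k : ℝ) + 1)) :=
    mul_pos (half_pos (div_pos hpos hxy.pos)) hk0
  linarith

variable {r : ℝ}

theorem tendsto_of_abs_sub_lt_one_div {ε : ℕ → ℝ} (h : ∀ k, |ε k - r| < 1 / ((k : ℝ) + 1))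
    {l : Filter ℕ} (hl : l ≤ atTop) : Tendsto ε l (𝓝 r) := by
  rw [tendsto_iff_norm_sub_tendsto_zero]
  exact squeeze_zero (fun _ => norm_nonneg _) (fun k => (h k).le)
    (tendsto_one_div_add_atTop_nhds_zero_nat.mono_left hl)

/-- Geometric simplicity of the rightmost eigenvalues persists for energies close to `r`. -/
theorem exists_secondSmallestSingularValue_pos (hn : 2 ≤ n) (hr : 0 < r)
    (hreg : ∀ D, P.IsWorstCase A r D → HasSimpleRightmost (A + D)) :
    ∃ η > 0, ∀ ε, |ε - r| < η → ∀ D, P.IsWorstCase A ε D → ∀ z, IsRightmost (A + D) z →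
      0 < secondSmallestSingularValue
        (toComplex (A + D) - z • (1 : Matrix (Fin n) (Fin n) ℂ)) := by
  have : NeZero n := ⟨by omega⟩
  by_contra! hcon
  choose ε hε D hD z hz hσ using fun k : ℕ => hcon (1 / ((k : ℝ) + 1)) (by positivity)
  -- Orthonormal pairs of eigenvectors survive the limit, where they contradict simplicity of the
  -- limiting rightmost eigenvalue.
  choose u v hu hv huv hBu hBv using fun k => exists_orthogonal_eigenvectors hn (not_lt.2 (hσ k))
  let U : Ultrafilter ℕ := Ultrafilter.of atTop
  have hεU : Tendsto ε U (𝓝 r) := tendsto_of_abs_sub_lt_one_div hε (Ultrafilter.of_le _)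
  obtain ⟨D₀, hD₀, hDlim⟩ := exists_tendsto_isWorstCase U hr hεU hD
  have hAD : Tendsto (fun k => A + D k) U (𝓝 (A + D₀)) := tendsto_const_nhds.add hDlim
  obtain ⟨z₀, hz₀, hzlim⟩ := U.exists_tendsto_isRightmost hAD hz
  have hB : Tendsto (fun k => toComplex (A + D k)) U (𝓝 (toComplex (A + D₀))) :=
    (continuous_toComplex.tendsto _).comp hAD
  obtain ⟨u₀, hulim⟩ := U.exists_tendsto_of_norm_le (f := u) (R := 1)
    (Eventually.of_forall fun k => (hu k).le)
  obtain ⟨v₀, hvlim⟩ := U.exists_tendsto_of_norm_le (f := v) (R := 1)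
    (Eventually.of_forall fun k => (hv k).le)
  have hu₀ := norm_eq_one_of_tendsto hulim (Eventually.of_forall hu)
  have hv₀ := norm_eq_one_of_tendsto hvlim (Eventually.of_forall hv)
  have huv₀ : inner ℂ u₀ v₀ = 0 :=
    tendsto_nhds_unique ((hulim.inner hvlim).congr huv) tendsto_const_nhds
  have hσ₀ := secondSmallestSingularValue_pos hn (hreg D₀ hD₀ z₀ hz₀).1
  have hu₀0 : u₀ ≠ 0 := by rintro rfl; simp at hu₀
  obtain ⟨c, hc⟩ := eigenvector_eq_smul hn hσ₀ hu₀0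
    (eigenvector_of_tendsto hB hulim hzlim (Eventually.of_forall hBu))
    (eigenvector_of_tendsto hB hvlim hzlim (Eventually.of_forall hBv))
  rw [hc, inner_smul_right, inner_self_eq_norm_sq_to_K, hu₀] at huv₀
  have hc0 : c = 0 := by simpa using huv₀
  rw [hc, hc0, zero_smul, norm_zero] at hv₀
  exact zero_ne_one hv₀

/-- For energies close to `r`, the rightmost eigenvalues of matrices close to `A + D`, where `D` is
a worst-case perturbation, are close to each other up to conjugation. -/
theorem exists_norm_sub_lt_of_isRightmost (hn : 2 ≤ n) (hr : 0 < r)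
    (hreg : ∀ D, P.IsWorstCase A r D → HasSimpleRightmost (A + D)) {η : ℝ} (hη : 0 < η) :
    ∃ δ > 0, ∀ ε, |ε - r| < δ → ∀ D, P.IsWorstCase A ε D → ∀ B', ‖B' - (A + D)‖ < δ →
      ∀ z z', IsRightmost (A + D) z → IsRightmost B' z' → ‖z' - z‖ < η ∨ ‖star z' - z‖ < η := by
  have : NeZero n := ⟨by omega⟩
  by_contra! hcon
  choose ε hε D hD B' hB' z z' hz hz' h1 h2 using
    fun k : ℕ => hcon (1 / ((k : ℝ) + 1)) (by positivity)
  let U : Ultrafilter ℕ := Ultrafilter.of atTop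
  have hεU : Tendsto ε U (𝓝 r) := tendsto_of_abs_sub_lt_one_div hε (Ultrafilter.of_le _)
  obtain ⟨D₀, hD₀, hDlim⟩ := exists_tendsto_isWorstCase U hr hεU hD
  have hAD : Tendsto (fun k => A + D k) U (𝓝 (A + D₀)) := tendsto_const_nhds.add hDlim
  have hB0 : Tendsto (fun k => B' k - (A + D k)) U (𝓝 0) := by
    refine tendsto_zero_iff_norm_tendsto_zero.2 ?_
    exact squeeze_zero (fun _ => norm_nonneg _) (fun k => (hB' k).le)
      (tendsto_one_div_add_atTop_nhds_zero_nat.mono_left (Ultrafilter.of_le _))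
  have hBlim : Tendsto B' U (𝓝 (A + D₀)) := by
    have := hB0.add hAD
    simpa using this
  obtain ⟨z₀, hz₀, hzlim⟩ := U.exists_tendsto_isRightmost hAD hz
  obtain ⟨z₁, hz₁, hz'lim⟩ := U.exists_tendsto_isRightmost hBlim hz'
  -- Both limits are rightmost eigenvalues of the same matrix `A + D₀`, hence equal or conjugate.
  rcases (hreg D₀ hD₀ z₀ hz₀).2 z₁ hz₁ with h | h
  · have h3 := ge_of_tendsto' (hz'lim.sub hzlim).norm h1
    rw [h, sub_self, norm_zero] at h3
    exact not_lt_of_ge h3 hη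
  · have h3 := ge_of_tendsto' (hz'lim.star.sub hzlim).norm h2
    rw [h, star_star, sub_self, norm_zero] at h3
    exact not_lt_of_ge h3 hη

/-- The structured pseudospectral abscissa grows at least linearly near a regular energy. -/
theorem exists_mul_sub_le_pseudoAbscissa (hn : 2 ≤ n) (hr : 0 < r) (hreg : P.IsRegularAt A r) :
    ∃ γ > 0, ∃ η > 0, ∀ ε ε', |ε - r| < η → |ε' - r| < η → 0 ≤ ε → ε < ε' →
      γ * (ε' - ε) ≤ P.pseudoAbscissa A ε' - P.pseudoAbscissa A ε := by
  have : NeZero n := ⟨by omega⟩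
  by_contra! hcon
  choose ε ε' hε hε' hε0 hlt hfail using fun k : ℕ =>
    hcon (1 / ((k : ℝ) + 1)) (by positivity) (1 / ((k : ℝ) + 1)) (by positivity)
  let U : Ultrafilter ℕ := Ultrafilter.of atTop
  have hεU : Tendsto ε U (𝓝 r) := tendsto_of_abs_sub_lt_one_div hε (Ultrafilter.of_le _)
  have hεU' : Tendsto ε' U (𝓝 r) := tendsto_of_abs_sub_lt_one_div hε' (Ultrafilter.of_le _)
  choose D hD using fun k => P.exists_isWorstCase A (hε0 k)
  choose z hz using fun k => exists_isRightmost (A + D k)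
  obtain ⟨D₀, hD₀, hDlim⟩ := exists_tendsto_isWorstCase U hr hεU hD
  have hAD : Tendsto (fun k => A + D k) U (𝓝 (A + D₀)) := tendsto_const_nhds.add hDlim
  obtain ⟨z₀, hz₀, hzlim⟩ := U.exists_tendsto_isRightmost hAD hz
  have hB : Tendsto (fun k => toComplex (A + D k)) U (𝓝 (toComplex (A + D₀))) :=
    (continuous_toComplex.tendsto _).comp hAD
  choose x y hxy using fun k => exists_isEigenPair (hz k).1
  obtain ⟨x₀, y₀, -, hylim, hxy₀⟩ := U.exists_tendsto_isEigenPair hB hzlim hxy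
  have hm := ((hreg D₀ hD₀).1 z₀ hz₀).1
  have hσ := secondSmallestSingularValue_pos hn hm
  obtain ⟨c, -, hRP⟩ := hxy₀.exists_isRPPair (hxy₀.inner_ne_zero hn hm)
  set x₁ := (c • x₀).ofLp with hx₁
  have hpair := (isRPPair_iff.1 hRP).1
  have hopt := hD₀.isLinearOptimizer hn hz₀ hRP hσ
  -- Non-saturation speaks of maximizers of the linear functional; it applies to `D₀` itself by the
  -- first-order condition.
  obtain ⟨i, j, hij, hlo, hhi, hne⟩ := (hreg D₀ hD₀).2 z₀ _ _ hz₀ hRP D₀ hopt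
  set m := gradMatrix x₁ y₀.ofLp i j with hmdef
  obtain ⟨s, hs1, hsm⟩ : ∃ s : ℝ, |s| ≤ 1 ∧ s * m = |m| := by
    rcases le_total 0 m with h | h
    · exact ⟨1, by simp, by rw [one_mul, abs_of_nonneg h]⟩
    · exact ⟨-1, by simp, by rw [abs_of_nonpos h]; ring⟩
  -- Direction of growth: the unsaturated entry alone, with the sign that makes ⟨G, M⟩ = |m|.
  set G : Matrix (Fin n) (Fin n) ℝ := Matrix.single i j s with hG
  have hGn : ‖G‖ ≤ 1 := by
    have h1 : ‖G‖ = ‖s‖ := by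
      rw [Matrix.frobenius_norm_def, Finset.sum_eq_single i, Finset.sum_eq_single j]
      · rw [hG, Matrix.single_apply_same, Real.rpow_two, ← Real.sqrt_eq_rpow,
          Real.sqrt_sq (norm_nonneg _)]
      · intro b _ hb; simp [hG, Matrix.single, hb.symm]
      · simp
      · intro b _ hb
        refine Finset.sum_eq_zero fun b' _ => ?_
        simp [hG, Matrix.single, hb.symm]
      · simp
    rw [h1]; exact hs1
  set t : ℕ → ℝ := fun k => ε' k - ε k with ht
  have htlim : Tendsto t U (𝓝 0) := by simpa [ht] using hεU'.sub hεU
  have ht0 : ∀ k, 0 < t k := fun k => sub_pos.2 (hlt k)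
  have hgsum : ∑ a, ∑ b, G a b * gradMatrix x₁ y₀.ofLp a b = |m| := by
    rw [Finset.sum_eq_single i, Finset.sum_eq_single j]
    · rw [hG, Matrix.single_apply_same, ← hmdef, hsm]
    · intro b _ hb; simp [hG, Matrix.single, hb.symm]
    · simp
    · intro b _ hb
      refine Finset.sum_eq_zero fun b' _ => ?_
      simp [hG, Matrix.single, hb.symm]
    · simp
  set γ := |m| / (star y₀.ofLp ⬝ᵥ x₁).re / 2 with hγ
  have hγ0 : 0 < γ := half_pos (div_pos (abs_pos.2 hne) hRP.pos)
  have hratio : γ < (inner ℂ (WithLp.toLp 2 y₀.ofLp : EuclideanSpace ℂ (Fin n))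
      (Matrix.toEuclideanLin (toComplex G) (WithLp.toLp 2 x₁)) /
      inner ℂ (WithLp.toLp 2 y₀.ofLp : EuclideanSpace ℂ (Fin n)) (WithLp.toLp 2 x₁)).re := by
    rw [hRP.inner_eq, Complex.div_ofReal_re, re_inner_toEuclideanLin, hgsum]
    exact half_lt_self (div_pos (abs_pos.2 hne) hRP.pos)
  have hev := Ultrafilter.eventually_exists_mem_spectrum hn U hB htlim ht0 hylim hxy hpair hσ
    (by rw [hRP.inner_eq]; exact_mod_cast hRP.pos.ne') hratio
  have hentry : Tendsto (fun k => ((D k i j + t k * s : ℝ) : EReal)) U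
      (𝓝 ((D₀ i j : ℝ) : EReal)) := by
    refine (continuous_coe_real_ereal.tendsto _).comp ?_
    have h1 : Tendsto (fun k => D k i j) U (𝓝 (D₀ i j)) :=
      ((continuous_id.matrix_elem i j).tendsto D₀).comp hDlim
    simpa using h1.add (htlim.mul_const s)
  have hsmall : ∀ᶠ k : ℕ in (U : Filter ℕ), 1 / ((k : ℝ) + 1) < γ :=
    (tendsto_one_div_add_atTop_nhds_zero_nat.mono_left (Ultrafilter.of_le _)).eventually
      (gt_mem_nhds hγ0)
  obtain ⟨k, ⟨w, hw, hle⟩, hklo, hkhi, hk⟩ := (hev.and ((hentry.eventually (lt_mem_nhds hlo)).and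
    ((hentry.eventually (gt_mem_nhds hhi)).and hsmall))).exists
  rw [← toComplex_smul, ← toComplex_add, add_assoc] at hw
  -- The triangle inequality spends exactly the extra energy ε' - ε. The changed entry respects its
  -- bounds for suitable `k` because its limit lies strictly between them.
  have hfeas : D k + t k • G ∈ P.feasible (ε' k) := by
    refine ⟨⟨fun a b hab => ?_, fun a b hab => ?_⟩, ?_⟩
    · have hne' : ¬ (i = a ∧ j = b) := by rintro ⟨rfl, rfl⟩; exact hab hij
      simp [hG, Matrix.single, hne', (hD k).1.1.1 a b hab]
    · by_cases heq : i = a ∧ j = b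
      · obtain ⟨rfl, rfl⟩ := heq
        have : (D k + t k • G) i j = D k i j + t k * s := by simp [hG]
        rw [this]
        exact ⟨hklo.le, hkhi.le⟩
      · have : (D k + t k • G) a b = D k a b := by simp [hG, Matrix.single, heq]
        rw [this]
        exact (hD k).1.1.2 a b hab
    · calc ‖D k + t k • G‖ ≤ ‖D k‖ + t k * ‖G‖ := by
            refine (norm_add_le _ _).trans ?_
            rw [norm_smul, Real.norm_of_nonneg (ht0 k).le]
        _ ≤ ε k + t k * 1 := by
            gcongr
            exacts [(hD k).1.2, (ht0 k).le]
        _ = ε' k := by simp [ht]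
  have h1 := (re_le_spectralAbscissa hw).trans (spectralAbscissa_le_pseudoAbscissa hfeas)
  have h2 := hfail k
  rw [(hD k).pseudoAbscissa_eq, ← (hz k).re_eq] at h2
  have h3 : 1 / ((k : ℝ) + 1) * t k ≤ γ * t k := mul_le_mul_of_nonneg_right hk.le (ht0 k).le
  simp only [ht] at h1 h2 h3 hle
  linarith

end PerturbationSet

/-! ### Correctness of the incremental construction of the saturated sets -/

theorem frobenius_norm_sq {n : ℕ} (D : Matrix (Fin n) (Fin n) ℝ) :
    ‖D‖ ^ 2 = ∑ i, ∑ j, D i j ^ 2 := by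
  rw [Matrix.frobenius_norm_def, ← Real.sqrt_eq_rpow, Real.sq_sqrt (by positivity)]
  simp

namespace PerturbationSet

variable {n : ℕ} (P : PerturbationSet n)

/-- The energy left for the unsaturated edges. -/
noncomputable def residualEnergy (ε : ℝ) (S : Finset (Fin n × Fin n) × Finset (Fin n × Fin n)) : ℝ :=
  ε ^ 2 - ∑ e ∈ S.1, (P.hi e.1 e.2).toReal ^ 2 - ∑ e ∈ S.2, (P.lo e.1 e.2).toReal ^ 2

/-- The weight of the unsaturated edges. -/
noncomputable def residualWeight (M : Matrix (Fin n) (Fin n) ℝ)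
    (S : Finset (Fin n × Fin n) × Finset (Fin n × Fin n)) : ℝ :=
  ∑ e ∈ P.edges \ (S.1 ∪ S.2), M e.1 e.2 ^ 2

theorem residualWeight_nonneg (M : Matrix (Fin n) (Fin n) ℝ)
    (S : Finset (Fin n × Fin n) × Finset (Fin n × Fin n)) : 0 ≤ P.residualWeight M S :=
  Finset.sum_nonneg fun _ _ => sq_nonneg _

/-- The invariant of the incremental construction of the index sets. -/
structure SaturationInvariant (ε : ℝ) (M : Matrix (Fin n) (Fin n) ℝ)
    (S : Finset (Fin n × Fin n) × Finset (Fin n × Fin n)) : Prop where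
  subset₁ : S.1 ⊆ P.edges
  subset₂ : S.2 ⊆ P.edges
  disjoint : Disjoint S.1 S.2
  energy_pos : 0 < P.residualEnergy ε S
  upper : ∀ e ∈ S.1, P.hi e.1 e.2 ≤ ((M e.1 e.2 * P.theta ε M S : ℝ) : EReal)
  lower : ∀ e ∈ S.2, ((M e.1 e.2 * P.theta ε M S : ℝ) : EReal) ≤ P.lo e.1 e.2

variable {P} {ε : ℝ} {M : Matrix (Fin n) (Fin n) ℝ}

/-- The value `toReal ⊤ = 0` would corrupt the energy sums; a bound dominated by a real number is
finite, so it never occurs on a saturated edge. -/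
theorem coe_toReal_hi {i j : Fin n} {a : ℝ} (h : P.hi i j ≤ (a : EReal)) :
    ((P.hi i j).toReal : EReal) = P.hi i j :=
  EReal.coe_toReal (fun ht => by rw [ht] at h; simp at h)
    (fun hb => by have := P.hi_nonneg i j; rw [hb] at this; simp at this)

theorem coe_toReal_lo {i j : Fin n} {a : ℝ} (h : (a : EReal) ≤ P.lo i j) :
    ((P.lo i j).toReal : EReal) = P.lo i j :=
  EReal.coe_toReal (fun ht => by have := P.lo_nonpos i j; rw [ht] at this; simp at this)
    (fun hb => by rw [hb] at h; simp at h)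

theorem toReal_hi_bounds {i j : Fin n} {a : ℝ} (h : P.hi i j ≤ (a : EReal)) :
    0 ≤ (P.hi i j).toReal ∧ (P.hi i j).toReal ≤ a := by
  have h0 := P.hi_nonneg i j
  have h1 := coe_toReal_hi h
  rw [← h1] at h h0
  exact ⟨by exact_mod_cast h0, by exact_mod_cast h⟩

theorem toReal_lo_bounds {i j : Fin n} {a : ℝ} (h : (a : EReal) ≤ P.lo i j) :
    (P.lo i j).toReal ≤ 0 ∧ a ≤ (P.lo i j).toReal := by
  have h0 := P.lo_nonpos i j
  have h1 := coe_toReal_lo h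
  rw [← h1] at h h0
  exact ⟨by exact_mod_cast h0, by exact_mod_cast h⟩

variable {S : Finset (Fin n × Fin n) × Finset (Fin n × Fin n)}

theorem theta_eq : P.theta ε M S = √(P.residualEnergy ε S / P.residualWeight M S) := rfl

theorem SaturationInvariant.theta_pos (h : P.SaturationInvariant ε M S)
    (hw : P.residualWeight M S ≠ 0) : 0 < P.theta ε M S := by
  rw [theta_eq]
  exact Real.sqrt_pos.2 (div_pos h.energy_pos ((P.residualWeight_nonneg M S).lt_of_ne' hw))

theorem SaturationInvariant.theta_sq (h : P.SaturationInvariant ε M S)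
    (hw : P.residualWeight M S ≠ 0) :
    P.theta ε M S ^ 2 * P.residualWeight M S = P.residualEnergy ε S := by
  rw [theta_eq, Real.sq_sqrt (div_nonneg h.energy_pos.le (P.residualWeight_nonneg M S)),
    div_mul_cancel₀ _ hw]

theorem subset_growSets_fst : S.1 ⊆ (P.growSets ε M S).1 := Finset.subset_union_left

theorem subset_growSets_snd : S.2 ⊆ (P.growSets ε M S).2 := Finset.subset_union_left

theorem residualWeight_growSets_le :
    P.residualWeight M (P.growSets ε M S) ≤ P.residualWeight M S :=
  Finset.sum_le_sum_of_subset_of_nonneg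
    (Finset.sdiff_subset_sdiff subset_rfl
      (Finset.union_subset_union subset_growSets_fst subset_growSets_snd))
    fun _ _ _ => sq_nonneg _

/-- A newly saturated edge takes at most its share θ²m² of the energy, since its bound is at most
θ|m| in modulus. So the remaining energy is at least θ² times the remaining weight: it stays
positive, θ does not decrease, and saturated edges remain saturated. -/
theorem SaturationInvariant.growSets (h : P.SaturationInvariant ε M S)
    (hw : P.residualWeight M (P.growSets ε M S) ≠ 0) :
    P.SaturationInvariant ε M (P.growSets ε M S) := by
  classical
  have hw' : 0 < P.residualWeight M (P.growSets ε M S) :=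
    (P.residualWeight_nonneg M _).lt_of_ne' hw
  have hwS : P.residualWeight M S ≠ 0 := (hw'.trans_le residualWeight_growSets_le).ne'
  have hθ := h.theta_pos hwS
  have hθsq := h.theta_sq hwS
  set θ := P.theta ε M S with hθdef
  set R := P.edges \ (S.1 ∪ S.2) with hR
  set N₁ := R.filter (fun e => P.hi e.1 e.2 ≤ ((M e.1 e.2 * θ : ℝ) : EReal)) with hN₁
  set N₂ := R.filter (fun e => ¬ P.hi e.1 e.2 ≤ ((M e.1 e.2 * θ : ℝ) : EReal) ∧
        ((M e.1 e.2 * θ : ℝ) : EReal) ≤ P.lo e.1 e.2) with hN₂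
  have hS' : P.growSets ε M S = (S.1 ∪ N₁, S.2 ∪ N₂) := by
    simp only [PerturbationSet.growSets, hN₁, hN₂, hR, hθdef]
  have hd₁ : Disjoint S.1 R := by
    rw [Finset.disjoint_left]; intro e he heR
    exact (Finset.mem_sdiff.1 heR).2 (Finset.mem_union_left _ he)
  have hd₂ : Disjoint S.2 R := by
    rw [Finset.disjoint_left]; intro e he heR
    exact (Finset.mem_sdiff.1 heR).2 (Finset.mem_union_right _ he)
  have hN₁R : N₁ ⊆ R := Finset.filter_subset _ _
  have hN₂R : N₂ ⊆ R := Finset.filter_subset _ _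
  have hNN : Disjoint N₁ N₂ := by
    rw [Finset.disjoint_left]; intro e he he'
    exact (Finset.mem_filter.1 he').2.1 (Finset.mem_filter.1 he).2
  have hu₁ : ∀ e ∈ N₁, P.hi e.1 e.2 ≤ ((M e.1 e.2 * θ : ℝ) : EReal) :=
    fun e he => (Finset.mem_filter.1 he).2
  have hu₂ : ∀ e ∈ N₂, ((M e.1 e.2 * θ : ℝ) : EReal) ≤ P.lo e.1 e.2 :=
    fun e he => (Finset.mem_filter.1 he).2.2
  have hweight : P.residualWeight M (P.growSets ε M S) + ∑ e ∈ N₁, M e.1 e.2 ^ 2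
      + ∑ e ∈ N₂, M e.1 e.2 ^ 2 = P.residualWeight M S := by
    have h1 : P.edges \ ((P.growSets ε M S).1 ∪ (P.growSets ε M S).2) = R \ (N₁ ∪ N₂) := by
      rw [hS', hR]
      ext e
      simp only [Finset.mem_sdiff, Finset.mem_union]
      tauto
    rw [residualWeight, h1, add_assoc, ← Finset.sum_union hNN,
      Finset.sum_sdiff (Finset.union_subset hN₁R hN₂R)]
    rfl
  have hb₁ : ∑ e ∈ N₁, (P.hi e.1 e.2).toReal ^ 2 ≤ θ ^ 2 * ∑ e ∈ N₁, M e.1 e.2 ^ 2 := by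
    rw [Finset.mul_sum]
    refine Finset.sum_le_sum fun e he => ?_
    obtain ⟨h1, h2⟩ := toReal_hi_bounds (hu₁ e he)
    rw [← mul_pow, mul_comm]
    exact pow_le_pow_left₀ h1 h2 2
  have hb₂ : ∑ e ∈ N₂, (P.lo e.1 e.2).toReal ^ 2 ≤ θ ^ 2 * ∑ e ∈ N₂, M e.1 e.2 ^ 2 := by
    rw [Finset.mul_sum]
    refine Finset.sum_le_sum fun e he => ?_
    obtain ⟨h1, h2⟩ := toReal_lo_bounds (hu₂ e he)
    rw [← mul_pow, mul_comm]
    nlinarith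
  have henergy : P.residualEnergy ε (P.growSets ε M S) = P.residualEnergy ε S
      - ∑ e ∈ N₁, (P.hi e.1 e.2).toReal ^ 2 - ∑ e ∈ N₂, (P.lo e.1 e.2).toReal ^ 2 := by
    rw [residualEnergy, residualEnergy, hS', Finset.sum_union (hd₁.mono_right hN₁R),
      Finset.sum_union (hd₂.mono_right hN₂R)]
    ring
  have hge : θ ^ 2 * P.residualWeight M (P.growSets ε M S) ≤
      P.residualEnergy ε (P.growSets ε M S) := by
    rw [henergy, ← hθsq, ← hweight]
    linarith
  have hθle : θ ≤ P.theta ε M (P.growSets ε M S) := by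
    rw [theta_eq]
    refine Real.le_sqrt_of_sq_le ?_
    rwa [le_div_iff₀ hw']
  -- As the upper bound is nonnegative and θ > 0, saturation forces m ≥ 0, so a larger θ preserves
  -- the inequality; `hlow` is the mirror case m ≤ 0.
  have hup : ∀ e : Fin n × Fin n, P.hi e.1 e.2 ≤ ((M e.1 e.2 * θ : ℝ) : EReal) →
      P.hi e.1 e.2 ≤ ((M e.1 e.2 * P.theta ε M (P.growSets ε M S) : ℝ) : EReal) := by
    intro e he
    refine he.trans (EReal.coe_le_coe_iff.2 ?_)
    obtain ⟨h1, h2⟩ := toReal_hi_bounds he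
    have hm : 0 ≤ M e.1 e.2 := nonneg_of_mul_nonneg_left (h1.trans h2) hθ
    gcongr
  have hlow : ∀ e : Fin n × Fin n, ((M e.1 e.2 * θ : ℝ) : EReal) ≤ P.lo e.1 e.2 →
      ((M e.1 e.2 * P.theta ε M (P.growSets ε M S) : ℝ) : EReal) ≤ P.lo e.1 e.2 := by
    intro e he
    refine le_trans (EReal.coe_le_coe_iff.2 ?_) he
    obtain ⟨h1, h2⟩ := toReal_lo_bounds he
    have hm : M e.1 e.2 ≤ 0 := nonpos_of_mul_nonpos_left (h2.trans h1) hθ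
    exact mul_le_mul_of_nonpos_left hθle hm
  refine ⟨?_, ?_, ?_, ?_, ?_, ?_⟩
  · rw [hS']; exact Finset.union_subset h.subset₁ (hN₁R.trans Finset.sdiff_subset)
  · rw [hS']; exact Finset.union_subset h.subset₂ (hN₂R.trans Finset.sdiff_subset)
  · rw [hS', Finset.disjoint_union_left, Finset.disjoint_union_right, Finset.disjoint_union_right]
    exact ⟨⟨h.disjoint, hd₁.mono_right hN₂R⟩, (hd₂.mono_right hN₁R).symm, hNN⟩
  · exact (mul_pos (pow_pos hθ 2) hw').trans_le hge
  · intro e he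
    refine hup e ?_
    rw [hS'] at he
    rcases Finset.mem_union.1 he with he | he
    exacts [h.upper e he, hu₁ e he]
  · intro e he
    refine hlow e ?_
    rw [hS'] at he
    rcases Finset.mem_union.1 he with he | he
    exacts [h.lower e he, hu₂ e he]

/-- The weight only decreases from pass to pass, so its being nonzero at pass `N` rules out a zero
denominator in all earlier passes. -/
theorem saturationInvariant_iterate (hε : 0 < ε) (N : ℕ)
    (hw : P.residualWeight M ((P.growSets ε M)^[N] (∅, ∅)) ≠ 0) :
    P.SaturationInvariant ε M ((P.growSets ε M)^[N] (∅, ∅)) := by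
  induction N with
  | zero =>
    refine ⟨by simp, by simp, by simp, ?_, by simp, by simp⟩
    simp only [residualEnergy, Function.iterate_zero, id, Finset.sum_empty, sub_zero]
    positivity
  | succ N ih =>
    rw [Function.iterate_succ_apply'] at hw ⊢
    refine (ih fun h0 => hw ?_).growSets hw
    exact le_antisymm (residualWeight_growSets_le.trans h0.le) (P.residualWeight_nonneg M _)

/-- The output of the incremental construction is a linear optimizer. -/
theorem LinearAlgReturns.isLinearOptimizer (hε : 0 < ε) {θ : ℝ} {D : Matrix (Fin n) (Fin n) ℝ}
    (h : P.LinearAlgReturns ε M θ D) : P.IsLinearOptimizer ε M D := by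
  classical
  obtain ⟨N, S, hS, hfix, -, hw, hθ, hD⟩ := h
  have hw : P.residualWeight M S ≠ 0 := hw
  have hinv : P.SaturationInvariant ε M S := by
    subst hS; exact saturationInvariant_iterate hε N hw
  have hθpos : 0 < θ := hθ ▸ hinv.theta_pos hw
  have hθsq : θ ^ 2 * P.residualWeight M S = P.residualEnergy ε S := hθ ▸ hinv.theta_sq hw
  have hup := hinv.upper
  have hlow := hinv.lower
  rw [← hθ] at hup hlow
  -- At a fixed point no remaining edge meets either saturation test.
  have hrest : ∀ e ∈ P.edges \ (S.1 ∪ S.2), P.lo e.1 e.2 < ((M e.1 e.2 * θ : ℝ) : EReal) ∧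
      ((M e.1 e.2 * θ : ℝ) : EReal) < P.hi e.1 e.2 := by
    intro e he
    have hnot := (Finset.mem_sdiff.1 he).2
    rw [Finset.mem_union, not_or] at hnot
    have h1 : ¬ P.hi e.1 e.2 ≤ ((M e.1 e.2 * θ : ℝ) : EReal) := by
      intro hle
      apply hnot.1
      rw [← hfix]
      exact Finset.mem_union_right _ (Finset.mem_filter.2 ⟨he, hθ ▸ hle⟩)
    refine ⟨?_, not_le.1 h1⟩
    by_contra hle
    apply hnot.2
    rw [← hfix]
    exact Finset.mem_union_right _ (Finset.mem_filter.2 ⟨he, hθ ▸ h1, hθ ▸ not_lt.1 hle⟩)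
  have hDout : ∀ i j, (i, j) ∉ P.edges → D i j = 0 := by
    intro i j hij; rw [hD]; simp [assemble, hij]
  have hD₁ : ∀ e ∈ S.1, D e.1 e.2 = (P.hi e.1 e.2).toReal := by
    intro e he; rw [hD]; simp [assemble, hinv.subset₁ he, he]
  have hD₂ : ∀ e ∈ S.2, D e.1 e.2 = (P.lo e.1 e.2).toReal := by
    intro e he
    have : e ∉ S.1 := Finset.disjoint_right.1 hinv.disjoint he
    rw [hD]; simp [assemble, hinv.subset₂ he, he, this]
  have hD₃ : ∀ e ∈ P.edges \ (S.1 ∪ S.2), D e.1 e.2 = M e.1 e.2 * θ := by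
    intro e he
    have h1 := Finset.mem_sdiff.1 he
    rw [Finset.mem_union, not_or] at h1
    rw [hD]; simp [assemble, h1.1, h1.2.1, h1.2.2]
  have hcases : ∀ e ∈ P.edges, e ∈ S.1 ∨ e ∈ S.2 ∨ e ∈ P.edges \ (S.1 ∪ S.2) := by
    intro e he
    simp only [Finset.mem_sdiff, Finset.mem_union]
    tauto
  have hcarrier : D ∈ P.carrier := by
    refine ⟨hDout, fun i j hij => ?_⟩
    rcases hcases (i, j) hij with he | he | he
    · have h1 : D i j = (P.hi i j).toReal := hD₁ (i, j) he
      rw [h1, coe_toReal_hi (hup (i, j) he)]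
      exact ⟨(P.lo_nonpos i j).trans (P.hi_nonneg i j), le_rfl⟩
    · have h1 : D i j = (P.lo i j).toReal := hD₂ (i, j) he
      rw [h1, coe_toReal_lo (hlow (i, j) he)]
      exact ⟨le_rfl, (P.lo_nonpos i j).trans (P.hi_nonneg i j)⟩
    · have h1 : D i j = M i j * θ := hD₃ (i, j) he
      rw [h1]
      exact ⟨(hrest (i, j) he).1.le, (hrest (i, j) he).2.le⟩
  -- The choice of θ spends exactly the residual energy on the unsaturated edges.
  have hnorm : ‖D‖ ^ 2 = ε ^ 2 := by
    rw [frobenius_norm_sq, ← Fintype.sum_prod_type' (f := fun i j => D i j ^ 2),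
      ← Finset.sum_subset (Finset.subset_univ P.edges)
        (fun e _ he => by rw [hDout e.1 e.2 he]; ring),
      ← Finset.sum_sdiff (Finset.union_subset hinv.subset₁ hinv.subset₂),
      Finset.sum_union hinv.disjoint, Finset.sum_congr rfl fun e he => by rw [hD₃ e he],
      Finset.sum_congr (s₁ := S.1) rfl fun e he => by rw [hD₁ e he],
      Finset.sum_congr (s₁ := S.2) rfl fun e he => by rw [hD₂ e he]]
    simp only [mul_pow]
    rw [← Finset.sum_mul, mul_comm]
    change θ ^ 2 * P.residualWeight M S + _ = _
    rw [hθsq, residualEnergy]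
    ring
  refine ⟨⟨hcarrier, (abs_le_of_sq_le_sq' hnorm.le hε.le).2⟩, fun D' hD' => ?_⟩
  -- Entrywise on the edges, `D` is the projection of θM onto the interval of admissible values, and
  -- `key` is its variational inequality: 2θM(D' - D) ≤ 2D(D' - D) ≤ D'² - D². The sum is
  -- nonpositive because ‖D'‖ ≤ ε = ‖D‖; so 1/(2θ) is the multiplier of the energy constraint.
  have hentry : ∀ i j, 2 * θ * (D' i j * M i j - D i j * M i j) ≤ D' i j ^ 2 - D i j ^ 2 := by
    intro i j
    have key : (D' i j - D i j) * (M i j * θ - D i j) ≤ 0 := by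
      by_cases hij : (i, j) ∈ P.edges
      · have hb := hD'.1.2 i j hij
        rcases hcases (i, j) hij with he | he | he
        · have h1 : D i j = (P.hi i j).toReal := hD₁ (i, j) he
          have h2 := (toReal_hi_bounds (hup (i, j) he)).2
          have h3 : D' i j ≤ (P.hi i j).toReal := by
            have h4 := hb.2
            rw [← coe_toReal_hi (hup (i, j) he)] at h4
            exact_mod_cast h4
          rw [h1]
          exact mul_nonpos_of_nonpos_of_nonneg (sub_nonpos.2 h3) (sub_nonneg.2 h2)
        · have h1 : D i j = (P.lo i j).toReal := hD₂ (i, j) he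
          have h2 := (toReal_lo_bounds (hlow (i, j) he)).2
          have h3 : (P.lo i j).toReal ≤ D' i j := by
            have h4 := hb.1
            rw [← coe_toReal_lo (hlow (i, j) he)] at h4
            exact_mod_cast h4
          rw [h1]
          exact mul_nonpos_of_nonneg_of_nonpos (sub_nonneg.2 h3) (sub_nonpos.2 h2)
        · have h1 : D i j = M i j * θ := hD₃ (i, j) he
          rw [h1, sub_self, mul_zero]
      · rw [hD'.1.1 i j hij, hDout i j hij]; simp
    nlinarith [sq_nonneg (D' i j - D i j)]
  have hsum : 2 * θ * (∑ i, ∑ j, D' i j * M i j - ∑ i, ∑ j, D i j * M i j) ≤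
      ‖D'‖ ^ 2 - ‖D‖ ^ 2 := by
    rw [frobenius_norm_sq, frobenius_norm_sq, ← Finset.sum_sub_distrib, ← Finset.sum_sub_distrib,
      Finset.mul_sum]
    refine Finset.sum_le_sum fun i _ => ?_
    rw [← Finset.sum_sub_distrib, ← Finset.sum_sub_distrib, Finset.mul_sum]
    exact Finset.sum_le_sum fun j _ => hentry i j
  have hle : ‖D'‖ ^ 2 - ‖D‖ ^ 2 ≤ 0 := by
    rw [hnorm, sub_nonpos]
    exact pow_le_pow_left₀ (norm_nonneg _) hD'.2 2
  exact sub_nonpos.1 (nonpos_of_mul_nonpos_right (hsum.trans hle) (by positivity))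

end PerturbationSet

/-! ### Error of the fixed-point iteration at termination -/

section

variable {n : ℕ}

/-- A corresponding right singular vector is stretched by exactly this factor. The upper bound on σ
converts a lower bound on σ s² into one on s. -/
theorem secondSmallestSingularValue_le_norm (hn : 2 ≤ n) (B : Matrix (Fin n) (Fin n) ℂ) :
    secondSmallestSingularValue B ≤ ‖B‖ := by
  set f := Matrix.toEuclideanLin B with hf
  have hfin : n - 2 < Module.finrank ℂ (EuclideanSpace ℂ (Fin n)) := by
    rw [finrank_euclideanSpace_fin]; omega
  obtain ⟨v, hv⟩ := (f.hasEigenvalue_adjoint_comp_self_sq_singularValues hfin).exists_hasEigenvector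
  have hσ : secondSmallestSingularValue B = f.singularValues (n - 2) := rfl
  rw [← hσ] at hv
  have h1 : ((‖f v‖ ^ 2 : ℝ) : ℂ) = ((secondSmallestSingularValue B ^ 2 * ‖v‖ ^ 2 : ℝ) : ℂ) := by
    have h2 : inner ℂ v ((f.adjoint ∘ₗ f) v) = ((‖f v‖ ^ 2 : ℝ) : ℂ) := by
      rw [LinearMap.comp_apply, LinearMap.adjoint_inner_right, inner_self_eq_norm_sq_to_K]
      simp
    rw [← h2, hv.apply_eq_smul, inner_smul_right, inner_self_eq_norm_sq_to_K]
    simp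
  have h2 : ‖f v‖ ^ 2 = (secondSmallestSingularValue B * ‖v‖) ^ 2 := by
    rw [mul_pow]; exact_mod_cast h1
  have h3 : ‖f v‖ = secondSmallestSingularValue B * ‖v‖ :=
    (sq_eq_sq₀ (norm_nonneg _)
      (mul_nonneg (secondSmallestSingularValue_nonneg B) (norm_nonneg _))).1 h2
  refine le_of_mul_le_mul_right ?_ (norm_pos_iff.2 hv.2)
  rw [← h3]
  exact norm_mulVec_le B v

theorem IsRPPair.inner_le_one {B : Matrix (Fin n) (Fin n) ℝ} {z : ℂ} {x y : Fin n → ℂ}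
    (h : IsRPPair B z x y) : (star y ⬝ᵥ x).re ≤ 1 := by
  have hp := (isRPPair_iff.1 h).1
  have := norm_inner_le_norm (𝕜 := ℂ) (WithLp.toLp 2 y : EuclideanSpace ℂ (Fin n))
    (WithLp.toLp 2 x)
  rwa [h.inner_eq, hp.unit_left, hp.unit_right, Complex.norm_real, Real.norm_of_nonneg h.pos.le,
    mul_one] at this

/-- Lipschitz bounds for a simple eigenvalue, up to conjugation, and for the associated matrix
`Re (y x*)`. -/
theorem IsRPPair.perturbation (hn : 2 ≤ n) {B B' : Matrix (Fin n) (Fin n) ℝ} {z z' : ℂ}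
    {x y x' y' : Fin n → ℂ} {σ : ℝ} (h : IsRPPair B z x y) (h' : IsRPPair B' z' x' y')
    (hσdef : σ = secondSmallestSingularValue
      (toComplex B - z • (1 : Matrix (Fin n) (Fin n) ℂ)))
    (hσ : 0 < σ)
    (hz : ‖z' - z‖ ≤ σ * (star y ⬝ᵥ x).re / 10 ∨ ‖star z' - z‖ ≤ σ * (star y ⬝ᵥ x).re / 10)
    (hB : ‖B' - B‖ ≤ σ * (star y ⬝ᵥ x).re ^ 3 / 25) :
    |z'.re - z.re| ≤ 2 / (star y ⬝ᵥ x).re * ‖B' - B‖ ∧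
    ‖gradMatrix x' y' - gradMatrix x y‖ ≤
      4 * √(n : ℝ) / (σ * (star y ⬝ᵥ x).re ^ 2) * ‖B' - B‖ := by
  -- If only the conjugate of z' is close to z, the second pair is conjugated; this changes neither
  -- the real part nor `gradMatrix`.
  wlog hz1 : ‖z' - z‖ ≤ σ * (star y ⬝ᵥ x).re / 10 generalizing z' x' y'
  · have := this h'.conj (Or.inl (hz.resolve_left hz1)) (hz.resolve_left hz1)
    rwa [gradMatrix_star, Complex.star_def, Complex.conj_re] at this
  subst hσdef
  have hnorm : ‖toComplex B' - toComplex B‖ = ‖B' - B‖ := by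
    rw [← toComplex_sub, norm_toComplex]
  obtain ⟨h1, h2⟩ := (isRPPair_iff.1 h).1.perturbation hn (isRPPair_iff.1 h').1 h.pos h'.pos
    h.inner_eq h'.inner_eq hσ hz1 (by rwa [hnorm])
  rw [hnorm] at h1 h2
  refine ⟨?_, (norm_gradMatrix_sub_le x y x' y').trans h2⟩
  rw [← Complex.sub_re]
  exact (Complex.abs_re_le_norm _).trans h1

end

/-- The error of the fixed-point iteration after its termination. -/
theorem InnerTrace.IsRun.error_bound {n : ℕ} (hn : 2 ≤ n) {P : PerturbationSet n}
    {A : Matrix (Fin n) (Fin n) ℝ} {ε εtol c δ σ s r : ℝ} {kmax : ℕ} {T : InnerTrace n}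
    (hT : T.IsRun P A ε εtol kmax) (hε : 0 < ε) (hc : 0 < c)
    {D : Matrix (Fin n) (Fin n) ℝ} (hD : P.IsWorstCase A ε D) {z : ℂ} {x y : Fin n → ℂ}
    (hz : IsRightmost (A + D) z) (hxy : IsRPPair (A + D) z x y)
    (hsens : P.IsSensitivityConst ε (gradMatrix x y) c δ)
    (hσdef : σ = secondSmallestSingularValue
      (toComplex (A + D) - z • (1 : Matrix (Fin n) (Fin n) ℂ)))
    (hσ : 0 < σ) (hs : s = (star y ⬝ᵥ x).re)
    (hr : r = 4 * √(n : ℝ) * c * ε / (σ * s ^ 2)) (hr1 : r < 1)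
    (hclose : ∀ j, j = T.last ∨ j = T.last + 1 →
      ‖T.pert j - D‖ ≤ σ * s ^ 3 / 25 ∧ ‖T.pert j - D‖ ≤ δ * (σ * s ^ 2) / (4 * √(n : ℝ)) ∧
      (‖T.eig j - z‖ ≤ σ * s / 10 ∨ ‖star (T.eig j) - z‖ ≤ σ * s / 10)) :
    |T.outAbscissa - spectralAbscissa (A + D)| ≤ 2 / s * (r / (1 - r) * εtol) := by
  have hs0 : 0 < s := hs ▸ hxy.pos
  have hn0 : (0 : ℝ) < √(n : ℝ) := Real.sqrt_pos.2 (by exact_mod_cast (by omega : 0 < n))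
  have hpert : ∀ j, j = T.last ∨ j = T.last + 1 →
      |(T.eig j).re - z.re| ≤ 2 / s * ‖T.pert j - D‖ ∧
      ‖gradMatrix (T.x j) (T.y j) - gradMatrix x y‖ ≤
        4 * √(n : ℝ) / (σ * s ^ 2) * ‖T.pert j - D‖ := by
    intro j hj
    obtain ⟨h1, -, h3⟩ := hclose j hj
    have hle : j ≤ T.last + 1 := by omega
    have h4 := hxy.perturbation hn (hT.vec_spec j hle) hσdef hσ (by rwa [← hs])
      (by rw [add_sub_add_left_eq_sub, ← hs]; exact h1)
    rwa [add_sub_add_left_eq_sub, ← hs] at h4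
  have hopt := hD.isLinearOptimizer hn hz hxy (hσdef ▸ hσ)
  have hopt' := (hT.step T.last le_rfl).isLinearOptimizer hε
  obtain ⟨-, hM⟩ := hpert T.last (Or.inl rfl)
  have hδ : ‖gradMatrix (T.x T.last) (T.y T.last) - gradMatrix x y‖ ≤ δ := by
    refine hM.trans ?_
    calc 4 * √(n : ℝ) / (σ * s ^ 2) * ‖T.pert T.last - D‖
        ≤ 4 * √(n : ℝ) / (σ * s ^ 2) * (δ * (σ * s ^ 2) / (4 * √(n : ℝ))) := by
          gcongr
          exact (hclose T.last (Or.inl rfl)).2.1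
      _ = δ := by field_simp
  have hcontr := hsens _ (hT.vec_spec T.last (Nat.le_succ _)).norm_gradMatrix_le hδ _ _ hopt hopt'
  have hr0 : 0 ≤ r := by rw [hr]; positivity
  have h1 : ‖T.pert (T.last + 1) - D‖ ≤ r * ‖T.pert T.last - D‖ := by
    refine hcontr.trans ?_
    calc c * ε * ‖gradMatrix (T.x T.last) (T.y T.last) - gradMatrix x y‖
        ≤ c * ε * (4 * √(n : ℝ) / (σ * s ^ 2) * ‖T.pert T.last - D‖) := by gcongr
      _ = r * ‖T.pert T.last - D‖ := by rw [hr]; ring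
  -- With d the distance to `D` before the last pass and d' the one after it, d' ≤ r d and d ≤ εtol
  -- + d' give (1 - r) d' ≤ r εtol.
  have h2 : ‖T.pert T.last - D‖ ≤ εtol + ‖T.pert (T.last + 1) - D‖ := by
    have h3 := norm_sub_le_norm_sub_add_norm_sub (T.pert T.last) (T.pert (T.last + 1)) D
    rw [norm_sub_rev (T.pert T.last) (T.pert (T.last + 1))] at h3
    exact h3.trans (by gcongr; exact hT.stopped)
  have h3 : ‖T.pert (T.last + 1) - D‖ ≤ r / (1 - r) * εtol := by
    rw [div_mul_eq_mul_div, le_div_iff₀ (sub_pos.2 hr1)]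
    nlinarith
  rw [← hz.re_eq]
  exact (hpert (T.last + 1) (Or.inr rfl)).1.trans (by gcongr)

/-- The safeguard ζ ε_l in the maximum prevents a Newton step from reaching zero or a negative
energy. -/
theorem NewtonTrace.IsRun.energy_pos {n : ℕ} {P : PerturbationSet n}
    {A : Matrix (Fin n) (Fin n) ℝ} {ε₀ εtol αtol ζ : ℝ} {kmax lmax : ℕ} {R : NewtonTrace n}
    (hR : R.IsRun P A ε₀ εtol αtol ζ kmax lmax) (hε₀ : 0 < ε₀) (hζ : 0 < ζ) :
    ∀ l ≤ R.last, 0 < R.energy l := by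
  intro l
  induction l with
  | zero => intro _; rw [hR.energy_zero]; exact hε₀
  | succ l ih =>
    intro hl
    rw [hR.newton l hl]
    exact lt_max_of_lt_right (mul_pos hζ (ih (Nat.le_of_succ_le hl)))

/-! ### From the abscissa back to the energy -/

namespace PerturbationSet

variable {n : ℕ} {P : PerturbationSet n} {A : Matrix (Fin n) (Fin n) ℝ}

/-- Near the stability radius, the structured pseudospectral abscissa controls the distance to
the stability radius, and a small abscissa forces the energy to be near the stability radius. -/
theorem exists_mul_abs_sub_le_abs_pseudoAbscissa (hn : 2 ≤ n) (hA : IsHurwitz A)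
    (hP : (P.destabilizing A).Nonempty) (hreg : P.IsRegularAt A (P.stabilityRadius A)) :
    ∃ γ > 0, (∃ η > 0, ∀ ε, 0 ≤ ε → |ε - P.stabilityRadius A| < η →
        γ * |ε - P.stabilityRadius A| ≤ |P.pseudoAbscissa A ε|) ∧
      ∀ η > 0, ∃ μ > 0, ∀ ε, 0 ≤ ε → |P.pseudoAbscissa A ε| < μ →
        |ε - P.stabilityRadius A| < η := by
  have : NeZero n := ⟨by omega⟩
  have hr := stabilityRadius_pos hA hP
  have hf := pseudoAbscissa_stabilityRadius hA hP
  set r := P.stabilityRadius A with hrdef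
  obtain ⟨γ, hγ, η₁, hη₁, hgrow⟩ := exists_mul_sub_le_pseudoAbscissa hn hr hreg
  have hloc : ∀ ε, 0 ≤ ε → |ε - r| < η₁ → γ * |ε - r| ≤ |P.pseudoAbscissa A ε| := by
    intro ε hε hεr
    rcases lt_trichotomy ε r with h | h | h
    · have := hgrow ε r hεr (by simpa using hη₁) hε h
      rw [hf] at this
      rw [abs_of_neg (sub_neg.2 h), abs_of_neg (pseudoAbscissa_neg_of_lt hε h)]
      linarith
    · rw [h, sub_self, abs_zero, mul_zero]; exact abs_nonneg _
    · have := hgrow r ε (by simpa using hη₁) hεr hr.le h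
      rw [hf, sub_zero] at this
      rw [abs_of_pos (sub_pos.2 h)]
      exact this.trans (le_abs_self _)
  refine ⟨γ, hγ, ⟨η₁, hη₁, hloc⟩, fun η hη => ?_⟩
  -- Both points r ± η' lie in the zone of linear growth and are nonnegative energies, so the
  -- abscissa there is at least γη' in modulus; monotonicity carries this bound to every energy
  -- further away.
  set η' := min η (min η₁ r) / 2 with hη'
  have hmin : 0 < min η (min η₁ r) := lt_min hη (lt_min hη₁ hr)
  have hη'0 : 0 < η' := half_pos hmin
  have hle1 : η' < η := (half_lt_self hmin).trans_le (min_le_left _ _)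
  have hle2 : η' < η₁ :=
    (half_lt_self hmin).trans_le ((min_le_right _ _).trans (min_le_left _ _))
  have hle3 : η' < r :=
    (half_lt_self hmin).trans_le ((min_le_right _ _).trans (min_le_right _ _))
  refine ⟨γ * η', mul_pos hγ hη'0, fun ε hε hfε => ?_⟩
  by_contra hcon
  rw [not_lt] at hcon
  have hup := hloc (r + η') (by linarith) (by simpa [abs_of_pos hη'0] using hle2)
  have hlow := hloc (r - η') (by linarith) (by simpa [abs_of_pos hη'0] using hle2)
  rw [add_sub_cancel_left, abs_of_pos hη'0] at hup
  rw [sub_sub_cancel_left, abs_neg, abs_of_pos hη'0,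
    abs_of_neg (pseudoAbscissa_neg_of_lt (by linarith) (by linarith))] at hlow
  rcases le_abs.1 hcon with h | h
  · have h1 : 0 ≤ P.pseudoAbscissa A (r + η') := by
      rw [← hf]; exact pseudoAbscissa_mono hr.le (by linarith)
    rw [abs_of_nonneg h1] at hup
    have h2 : P.pseudoAbscissa A (r + η') ≤ P.pseudoAbscissa A ε :=
      pseudoAbscissa_mono (by linarith) (by linarith)
    linarith [le_abs_self (P.pseudoAbscissa A ε)]
  · have h2 : P.pseudoAbscissa A ε ≤ P.pseudoAbscissa A (r - η') :=
      pseudoAbscissa_mono hε (by linarith)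
    linarith [neg_abs_le (P.pseudoAbscissa A ε)]

end PerturbationSet

/-! ### Uniform constants and the error bound -/

theorem norm_sub_smul_one_le {n : ℕ} {A D : Matrix (Fin n) (Fin n) ℝ} {z : ℂ} {ε : ℝ}
    (hD : ‖D‖ ≤ ε) (hz : z ∈ spectrum ℂ (toComplex (A + D))) :
    ‖toComplex (A + D) - z • (1 : Matrix (Fin n) (Fin n) ℂ)‖ ≤
      (‖A‖ + ε) * (1 + ‖(1 : Matrix (Fin n) (Fin n) ℂ)‖) := by
  have h1 : ‖toComplex (A + D)‖ ≤ ‖A‖ + ε := by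
    rw [norm_toComplex]; exact (norm_add_le _ _).trans (by gcongr)
  have h2 := (norm_le_of_mem_spectrum hz).trans h1
  calc _ ≤ ‖toComplex (A + D)‖ + ‖z • (1 : Matrix (Fin n) (Fin n) ℂ)‖ := norm_sub_le _ _
    _ ≤ (‖A‖ + ε) + (‖A‖ + ε) * ‖(1 : Matrix (Fin n) (Fin n) ℂ)‖ := by
        rw [norm_smul]; gcongr
    _ = _ := by ring

theorem mainTheorem5 {n : ℕ} (hn : 2 ≤ n)
    (A : Matrix (Fin n) (Fin n) ℝ) (hA : IsHurwitz A)
    (P : PerturbationSet n) (hP : (P.destabilizing A).Nonempty)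
    (hreg : P.IsRegularAt A (P.stabilityRadius A))
    (c δ : ℝ) (hc : 0 < c) (hδ : 0 < δ) :
    ∃ C : ℝ, 0 < C ∧
      ∀ (ι : Type) (L : Filter ι) (εtol αtol ε₀ ζ : ι → ℝ) (kmax lmax : ι → ℕ)
        (R : ι → NewtonTrace n) (Dopt : ι → Matrix (Fin n) (Fin n) ℝ)
        (z : ι → ℂ) (x y : ι → Fin n → ℂ) (r : ι → ℝ),
        Tendsto εtol L (𝓝[>] 0) → Tendsto αtol L (𝓝[>] 0) →
        (∀ t, 0 < ε₀ t) → (∀ t, ζ t ∈ Set.Ioo 0 1) →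
        (∀ t, (R t).IsRun P A (ε₀ t) (εtol t) (αtol t) (ζ t) (kmax t) (lmax t)) →
        -- in every outer iteration the inner algorithm converges to the abscissa, and in the
        -- terminal one its perturbation converges to a worst-case perturbation
        (∀ η > 0, ∀ᶠ t in L, ∀ l ≤ (R t).last,
          |((R t).inner l).outAbscissa - P.pseudoAbscissa A ((R t).energy l)| ≤ η) →
        (∀ t, P.IsWorstCase A (R t).finalEnergy (Dopt t)) →
        Tendsto (fun t => ‖((R t).inner (R t).last).outPert - Dopt t‖) L (𝓝 0) →
        -- the rate `r` at the terminal energy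
        (∀ t, IsRightmost (A + Dopt t) (z t)) →
        (∀ t, IsRPPair (A + Dopt t) (z t) (x t) (y t)) →
        (∀ t, P.IsSensitivityConst (R t).finalEnergy (gradMatrix (x t) (y t)) c δ) →
        (∀ t, r t =
          convergenceRate c (R t).finalEnergy (A + Dopt t) (z t) (x t) (y t)) →
        (∀ t, r t < 1) →
        ∀ᶠ t in L, |(R t).finalEnergy - P.stabilityRadius A| ≤
          C * (r t / (1 - r t) * εtol t + αtol t) := by
  have : NeZero n := ⟨by omega⟩
  have hr₀ := PerturbationSet.stabilityRadius_pos hA hP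
  obtain ⟨γ, hγ, ⟨η₁, hη₁, hloc⟩, hglob⟩ :=
    PerturbationSet.exists_mul_abs_sub_le_abs_pseudoAbscissa hn hA hP hreg
  set r₀ := P.stabilityRadius A with hr₀def
  obtain ⟨η₂, hη₂, hsimple⟩ := PerturbationSet.exists_secondSmallestSingularValue_pos hn hr₀
    fun D hD => (hreg D hD).1
  -- Uniform lower bound for σ s²: r < 1 means 4√n c ε < σ s², and ε ≥ r₀/2 eventually.
  set κ := c * (r₀ / 2) with hκ
  have hκ0 : 0 < κ := by positivity
  -- The perturbation bounds require eigenvalues within σ s/10, which varies along the family; since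
  -- κ ≤ σ s² ≤ σ s, the fixed radius κ/10 is enough.
  obtain ⟨η₃, hη₃, hnear⟩ := PerturbationSet.exists_norm_sub_lt_of_isRightmost hn hr₀
    (fun D hD => (hreg D hD).1) (η := κ / 10) (by positivity)
  set K := (‖A‖ + (r₀ + 1)) * (1 + ‖(1 : Matrix (Fin n) (Fin n) ℂ)‖) with hK
  have hK0 : 0 < K := by positivity
  -- As `K` bounds σ from above, κ ≤ σ s² ≤ K s² gives s ≥ s₀.
  set s₀ := √(κ / K) with hs₀
  have hs₀0 : 0 < s₀ := Real.sqrt_pos.2 (by positivity)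
  -- The factor 1/γ converts abscissa into energy, 2/s₀ bounds the eigenvalue sensitivity, and 1
  -- accounts for α_tol.
  refine ⟨(2 / s₀ + 1) / γ, by positivity, ?_⟩
  intro ι L εtol αtol ε₀ ζ kmax lmax R Dopt z x y r hεtol hαtol hε₀ hζ hR hconv hD hDlim hz hxy
    hsens hrate hr1
  have hn1 : (1 : ℝ) ≤ √(n : ℝ) :=
    Real.one_le_sqrt.2 (by exact_mod_cast (by omega : 1 ≤ n))
  have hε : ∀ t, 0 < (R t).finalEnergy := fun t =>
    (hR t).energy_pos (hε₀ t) (hζ t).1 _ le_rfl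
  have hεtol0 : Tendsto εtol L (𝓝 0) := hεtol.mono_right nhdsWithin_le_nhds
  have hαtol0 : Tendsto αtol L (𝓝 0) := hαtol.mono_right nhdsWithin_le_nhds
  -- the terminal energy is close to the stability radius
  obtain ⟨μ, hμ, hμη⟩ := hglob (min (min η₁ η₂) (min η₃ (min (r₀ / 2) 1))) (by positivity)
  -- the last two perturbations are close to the worst-case perturbation
  set ρ := min η₃ (min (κ * s₀ / 25) (δ * κ / (4 * √(n : ℝ)))) with hρ
  have hρ0 : 0 < ρ := by positivity
  filter_upwards [hαtol0.eventually (gt_mem_nhds (half_pos hμ)), hconv (μ / 4) (by positivity),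
    hDlim.eventually (gt_mem_nhds (half_pos hρ0)), hεtol0.eventually (gt_mem_nhds (half_pos hρ0))]
    with t htα htconv htD htε
  set T := (R t).inner (R t).last with hT
  have hrun : T.IsRun P A (R t).finalEnergy (εtol t) (kmax t) := (hR t).inner_run _ le_rfl
  have hout : |T.outAbscissa| ≤ αtol t := (hR t).stopped
  have hf := htconv _ le_rfl
  change |T.outAbscissa - P.pseudoAbscissa A (R t).finalEnergy| ≤ μ / 4 at hf
  set ε := (R t).finalEnergy with hεdef
  -- The tolerance contributes less than μ/2 and the inner error at most μ/4.
  have hfμ : |P.pseudoAbscissa A ε| < μ := by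
    have := abs_sub_abs_le_abs_sub (P.pseudoAbscissa A ε) T.outAbscissa
    rw [abs_sub_comm] at this
    linarith
  have hεr := hμη ε (hε t).le hfμ
  rw [lt_min_iff, lt_min_iff, lt_min_iff, lt_min_iff] at hεr
  obtain ⟨⟨hε1, hε2⟩, hε3, hε4, hε5⟩ := hεr
  have hεlow : r₀ / 2 ≤ ε := by linarith [(abs_lt.1 hε4).1]
  have hεup : ε ≤ r₀ + 1 := by linarith [(abs_lt.1 hε5).2]
  -- lower bounds for the singular value and for `y* x`
  have hσ := hsimple ε hε2 _ (hD t) _ (hz t)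
  set σ := secondSmallestSingularValue
    (toComplex (A + Dopt t) - z t • (1 : Matrix (Fin n) (Fin n) ℂ)) with hσdef
  set s := (star (y t) ⬝ᵥ x t).re with hs
  have hs0 : 0 < s := (hxy t).pos
  have hs1 : s ≤ 1 := (hxy t).inner_le_one
  have hr_eq : r t = 4 * √(n : ℝ) * c * ε / (σ * s ^ 2) := hrate t
  have hκσ : κ ≤ σ * s ^ 2 := by
    have h1 := hr1 t
    rw [hr_eq, div_lt_one (by positivity)] at h1
    have h2 : κ ≤ c * ε := by rw [hκ]; gcongr
    have h3 : 1 * (c * ε) ≤ 4 * √(n : ℝ) * (c * ε) :=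
      mul_le_mul_of_nonneg_right (by linarith) (mul_nonneg hc.le (hε t).le)
    linarith
  have hσK : σ ≤ K := by
    refine (secondSmallestSingularValue_le_norm hn _).trans ?_
    exact norm_sub_smul_one_le ((hD t).1.2.trans hεup) (hz t).1
  have hss : s₀ ≤ s := by
    refine Real.sqrt_le_iff.2 ⟨hs0.le, ?_⟩
    rw [div_le_iff₀ hK0, mul_comm]
    exact hκσ.trans (by gcongr)
  have hκσ1 : κ / 10 ≤ σ * s / 10 := by
    have : σ * s ^ 2 ≤ σ * s := by
      gcongr
      nlinarith
    linarith
  have hκσ3 : κ * s₀ / 25 ≤ σ * s ^ 3 / 25 := by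
    have : κ * s₀ ≤ σ * s ^ 2 * s := by gcongr
    linarith
  -- Convergence is assumed for the returned perturbation only; the one before it differs from it by
  -- at most εtol < ρ/2.
  have hclose : ∀ j, j = T.last ∨ j = T.last + 1 → ‖T.pert j - Dopt t‖ < ρ := by
    rintro j (rfl | rfl)
    · have h1 := norm_sub_le_norm_sub_add_norm_sub (T.pert T.last) (T.pert (T.last + 1)) (Dopt t)
      rw [norm_sub_rev (T.pert T.last) (T.pert (T.last + 1))] at h1
      have h2 := hrun.stopped
      change ‖T.pert (T.last + 1) - Dopt t‖ < ρ / 2 at htD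
      linarith
    · change ‖T.pert (T.last + 1) - Dopt t‖ < ρ / 2 at htD
      linarith
  have hbound := hrun.error_bound hn (hε t) hc (hD t) (hz t) (hxy t) (hsens t) hσdef hσ hs hr_eq
    (hr1 t) (by
      intro j hj
      have h1 := hclose j hj
      rw [hρ, lt_min_iff, lt_min_iff] at h1
      refine ⟨h1.2.1.le.trans hκσ3, h1.2.2.le.trans (by gcongr), ?_⟩
      have h2 := hnear ε hε3 _ (hD t) (A + T.pert j)
        (by rw [add_sub_add_left_eq_sub]; exact h1.1) _ _ (hz t)
        (hrun.eig_spec j (by omega))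
      exact h2.imp (fun h => h.le.trans hκσ1) fun h => h.le.trans hκσ1)
  have hr0 : 0 ≤ r t := by rw [hr_eq]; have := hε t; positivity
  have htol : 0 ≤ εtol t := (norm_nonneg _).trans hrun.stopped
  have hα : 0 ≤ αtol t := (abs_nonneg _).trans hout
  have hq : 0 ≤ r t / (1 - r t) * εtol t :=
    mul_nonneg (div_nonneg hr0 (sub_nonneg.2 (hr1 t).le)) htol
  have hfb : |P.pseudoAbscissa A ε| ≤ αtol t + 2 / s₀ * (r t / (1 - r t) * εtol t) := by
    have h1 := abs_sub_abs_le_abs_sub (P.pseudoAbscissa A ε) T.outAbscissa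
    rw [abs_sub_comm, (hD t).pseudoAbscissa_eq] at h1
    rw [(hD t).pseudoAbscissa_eq]
    have h2 : 2 / s * (r t / (1 - r t) * εtol t) ≤ 2 / s₀ * (r t / (1 - r t) * εtol t) := by
      gcongr
    linarith
  rw [div_mul_eq_mul_div, le_div_iff₀ hγ, mul_comm]
  refine (hloc ε (hε t).le hε1).trans (hfb.trans ?_)
  have h3 : 0 ≤ 2 / s₀ * αtol t := by positivity
  linarith
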